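/- Let $D=\{z\in\mathbb C:|z|<1\}$. Write $\mathcal{HK}$ for the set of $2\pi$-periodic functions $f:\mathbb R\to\mathbb R$ that are Henstock--Kurzweil integrable on every bounded interval and have finite Alexiewicz norm $$\|f\|:=\sup_I\Big|\int_I f\Big|,$$ where $I$ ranges over the intervals in $\mathbb R$ of length at most $2\pi$. For $0\le r<1$ let $\Phi_r(\theta)=\dfrac{1-r^2}{2\pi(1-2r\cos\theta+r^2)}$ be the Poisson kernel and, for $f\in\mathcal{HK}$, let $$P[f](re^{i\theta})=\int_{-\pi}^{\pi}f(\phi)\,\Phi_r(\phi-\theta)\,d\phi$$ (Henstock--Kurzweil integral) be the Poisson integral of $f$. For $u:D\to\mathbb R$ write $u_r(\theta)=u(re^{i\theta})$. **Theorem.** Let $u:D\to\mathbb R$ be harmonic in $D$ and suppose that there is $f\in\mathcal{HK}$ such that 1. $u_r(\theta)\to f(\theta)$ as $r\to1^-$ for each $\theta\in[-\pi,\pi)$, and 2. $\|u_r\|=o(1/(1-r))$ as $r\to1^-$, i.e. $(1-r)\|u_r\|\to0$. Then $u=P[f]$ in $D$; that is, for all $0\le r<1$ and $\theta\in\mathbb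 R$ the integral defining $P[f](re^{i\theta})$ exists and equals $u(re^{i\theta})$. -/

import Mathlib

open Set Filter Topology

noncomputable section

namespace HKDirichlet

/-- The interval from `a` to `b`, as a one-dimensional box. -/
def ivl (a b : ℝ) (h : a < b) : BoxIntegral.Box (Fin 1) :=
  ⟨fun _ => a, fun _ => b, fun _ => h⟩

/-- `f` is Henstock–Kurzweil integrable on the interval from `a` to `b`, where `a < b`. -/
def HKIntegrable (f : ℝ → ℝ) (a b : ℝ) : Prop :=
  ∃ h : a < b, BoxIntegral.Integrable (ivl a b h) BoxIntegral.IntegrationParams.Henstock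
    (fun x : Fin 1 → ℝ => f (x 0)) BoxIntegral.BoxAdditiveMap.volume

/-- The Henstock–Kurzweil integral of `f` from `a` to `b`, where `a < b`. It is only meaningful
when `HKIntegrable f a b` holds. -/
def hkIntegral (f : ℝ → ℝ) (a b : ℝ) : ℝ :=
  if h : a < b then
    BoxIntegral.integral (ivl a b h) BoxIntegral.IntegrationParams.Henstock
      (fun x : Fin 1 → ℝ => f (x 0)) BoxIntegral.BoxAdditiveMap.volume
  else 0

/-- The Alexiewicz norm on the circle: the supremum of the absolute values of the integrals of `f`
over the intervals of length at most `2π` (intervals of length zero contribute nothing).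
It is used for functions that are Henstock–Kurzweil integrable on every bounded interval. -/
def alexiewiczNorm (f : ℝ → ℝ) : ENNReal :=
  ⨆ (a : ℝ) (b : ℝ) (_ : a < b ∧ b - a ≤ 2 * Real.pi), ENNReal.ofReal |hkIntegral f a b|

/-- The class of `2π`-periodic functions `f : ℝ → ℝ` that are Henstock–Kurzweil integrable
(on every bounded interval), with finite Alexiewicz norm. -/
structure MemHK (f : ℝ → ℝ) : Prop where
  periodic : Function.Periodic f (2 * Real.pi)
  integrable : ∀ a b : ℝ, a < b → HKIntegrable f a b
  norm_finite : alexiewiczNorm f < ⊤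

/-- The Poisson kernel `Φ_r(θ)`. -/
def poissonKer (r θ : ℝ) : ℝ :=
  (1 - r ^ 2) / (2 * Real.pi * (1 - 2 * r * Real.cos θ + r ^ 2))

/-- The Poisson integral `P[f](r e^{iθ})`, as a Henstock–Kurzweil integral. -/
def poissonInt (f : ℝ → ℝ) (r θ : ℝ) : ℝ :=
  hkIntegral (fun φ => f φ * poissonKer r (φ - θ)) (-Real.pi) Real.pi

/-- The function `u_r(θ) = u(r e^{iθ})`. -/
def circleFun (u : ℂ → ℝ) (r θ : ℝ) : ℝ :=
  u ((r : ℂ) * Complex.exp ((θ : ℂ) * Complex.I))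

end HKDirichlet

end

noncomputable section

namespace HKDirichlet

/-! Let `F` be a Henstock–Kurzweil primitive of `f`. Integration by parts (`hasIntegral_mul`) turns
`P[f]` into the Poisson–Stieltjes integral of `dF`, which involves only the continuous function `F`.
Replacing `u`, `f` by `-u`, `-f`, it suffices to prove `u ≤ P[dF]`.

Given `ε > 0`, the Saks–Henstock lemma yields an increasing `E` with values in `[0, ε]` such that `F
+ E` is a major function of `f` (`exists_monotone_majorant`). Its symmetric difference quotients
over short intervals about `θ` are at least `f θ`, so the lower radial limit of `P[dF] + P[dE]` at
`θ` is at least `f θ` (`eventually_le_poissonStieltjes_add`). Hence `w = u - P[dF] - P[dE]` is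
harmonic with upper radial limit at most `0` at every boundary point, without exception. Integrating
the Poisson formula by parts on a slightly larger circle turns the norm hypothesis into `u = o((1 -
|z|)⁻²)`; since `P[dF] = O((1 - |z|)⁻¹)` and `P[dE] ≥ 0`, `w` obeys the same bound from above. A
maximum principle (`nonpos_of_forall_radial_limsup_nonpos`) gives `w ≤ 0`, and `P[dE] ≤ ε / (1 - r)`
disappears as `ε → 0`.

The maximum principle is the hard part. The exponent `2` is critical: the angular derivative of the
Poisson kernel has radial limit `0` everywhere and growth of order `(1 - |z|)⁻²`. After pulling back
to the upper half plane, let `Z` be the closed set of boundary points near which unrestricted upper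
limits are not under control. If `Z` were nonempty, Baire's theorem would give a portion of `Z`
above which the radial bound holds up to a uniform height. Over each gap of that portion, a
Phragmén–Lindelöf argument in a half strip (`le_add_of_halfStrip`) carries the bound inwards,
uniformly over the gaps, so the portion was controlled after all. Near the base of the strip, growth
`ε / y²` is converted into a genuine bound by a Domar type estimate (`le_of_le_div_im_sq`). -/

/-! ### Maximum principle for functions that are harmonic where they are positive -/

/-- Near `z`, the function `g` is the real part of a holomorphic function. -/
def LocallyReAt (g : ℂ → ℝ) (z : ℂ) : Prop :=
  ∃ H : ℂ → ℂ, AnalyticAt ℂ H z ∧ ∀ᶠ p in 𝓝 z, g p = (H p).re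

theorem LocallyReAt.sub_re {g : ℂ → ℝ} {z : ℂ} (hg : LocallyReAt g z) {h : ℂ → ℝ} {H : ℂ → ℂ}
    (hH : AnalyticAt ℂ H z) (hh : ∀ᶠ p in 𝓝 z, h p = (H p).re) :
    LocallyReAt (fun p => g p - h p) z := by
  obtain ⟨G, hG, hgG⟩ := hg
  refine ⟨fun p => G p - H p, hG.sub hH, ?_⟩
  filter_upwards [hgG, hh] with p h1 h2
  rw [h1, h2, Complex.sub_re]

/-- If `g = Re H`, then `|exp H| = exp g`, so the strong maximum modulus principle for `exp ∘ H`
applies. -/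
theorem LocallyReAt.eventually_eq_of_isLocalMax {g : ℂ → ℝ} {z : ℂ} (hg : LocallyReAt g z)
    (hmax : ∀ᶠ p in 𝓝 z, g p ≤ g z) : ∀ᶠ p in 𝓝 z, g p = g z := by
  obtain ⟨H, hH, hgH⟩ := hg
  have hz := hgH.self_of_nhds
  have h1 : ∀ᶠ p in 𝓝 z, DifferentiableAt ℂ (fun q => Complex.exp (H q)) p :=
    hH.eventually_analyticAt.mono fun p hp => hp.differentiableAt.cexp
  have h2 : IsLocalMax (norm ∘ fun q => Complex.exp (H q)) z := by
    filter_upwards [hmax, hgH] with p hp hp'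
    simp only [Function.comp, Complex.norm_exp]
    rw [← hp', ← hz]
    exact Real.exp_le_exp.2 hp
  filter_upwards [Complex.norm_eventually_eq_of_isLocalMax h1 h2, hgH] with p hp hp'
  simp only [Complex.norm_exp] at hp
  rw [hp', hz, Real.exp_injective hp]

/-- Asking for harmonicity only where `g > 0` lets the principle apply to truncations `max (W - η)
0` minus a barrier. Boundary values need no separate hypothesis: a point with `g > 0` is required to
be interior to `K`. -/
theorem nonpos_of_locallyReAt_of_pos {K : Set ℂ} (hK : IsCompact K) {g : ℂ → ℝ}
    (hg : ContinuousOn g K) (hpos : ∀ z ∈ K, 0 < g z → K ∈ 𝓝 z ∧ LocallyReAt g z) :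
    ∀ z ∈ K, g z ≤ 0 := by
  intro z hz
  by_contra! hz0
  obtain ⟨z₀, hz₀, hmax⟩ := hK.exists_isMaxOn ⟨z, hz⟩ hg
  have hm : 0 < g z₀ := hz0.trans_le (hmax hz)
  have hcl : IsCompact (K ∩ g ⁻¹' {g z₀}) :=
    hK.of_isClosed_subset (hg.preimage_isClosed_of_isClosed hK.isClosed isClosed_singleton)
      inter_subset_left
  -- The rightmost point of the maximum set: `g` is constant near it, so the maximum is also
  -- attained slightly further to the right, a contradiction.
  obtain ⟨z₁, hz₁, hre⟩ := hcl.exists_isMaxOn ⟨z₀, hz₀, rfl⟩ Complex.continuous_re.continuousOn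
  have hz1 : g z₁ = g z₀ := hz₁.2
  obtain ⟨hn, hL⟩ := hpos z₁ hz₁.1 (hz1 ▸ hm)
  have h1 : ∀ᶠ p in 𝓝 z₁, g p = g z₁ := hL.eventually_eq_of_isLocalMax <| by
    filter_upwards [hn] with p hp
    rw [hz1]; exact hmax hp
  have h2 : Tendsto (fun t : ℝ => z₁ + t) (𝓝[>] 0) (𝓝 z₁) := by
    have : Tendsto (fun t : ℝ => z₁ + t) (𝓝 0) (𝓝 (z₁ + (0 : ℝ))) :=
      Continuous.tendsto (by fun_prop) 0
    simpa using this.mono_left nhdsWithin_le_nhds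
  obtain ⟨t, ⟨ht1, ht2⟩, ht0⟩ :=
    ((h2.eventually (h1.and hn)).and self_mem_nhdsWithin).exists
  have := hre (show z₁ + (t : ℂ) ∈ K ∩ g ⁻¹' {g z₀} from ⟨ht2, by simpa [hz1] using ht1⟩)
  simp at this
  exact absurd ht0 (by simpa using this)

theorem reProdIm_Icc_mem_nhds {a b c d : ℝ} {z : ℂ} (h1 : a < z.re) (h2 : z.re < b)
    (h3 : c < z.im) (h4 : z.im < d) : Icc a b ×ℂ Icc c d ∈ 𝓝 z := by
  have : Ioo a b ×ℂ Ioo c d ∈ 𝓝 z :=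
    (isOpen_Ioo.reProdIm isOpen_Ioo).mem_nhds ⟨⟨h1, h2⟩, ⟨h3, h4⟩⟩
  refine mem_of_superset this fun p hp => ?_
  exact ⟨Ioo_subset_Icc_self hp.1, Ioo_subset_Icc_self hp.2⟩

/-! ### A Domar type estimate -/

/-- A nonnegative function on a box that vanishes on the bottom edge, is harmonic where it is
positive and is bounded by `ε / y²` is bounded by a multiple of `ε / R²` on the axis of the box. -/
theorem le_of_le_div_im_sq {s : ℂ → ℝ} {x₀ R ε : ℝ} (hR : 0 < R) (hε : 0 < ε)
    (hc : ContinuousOn s (Icc (x₀ - R) (x₀ + R) ×ℂ Icc 0 (2 * R)))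
    (hbot : ∀ z ∈ Icc (x₀ - R) (x₀ + R) ×ℂ Icc 0 (2 * R), z.im = 0 → s z = 0)
    (hharm : ∀ z ∈ Icc (x₀ - R) (x₀ + R) ×ℂ Icc 0 (2 * R), 0 < s z → LocallyReAt s z)
    (hgrowth : ∀ z ∈ Icc (x₀ - R) (x₀ + R) ×ℂ Icc 0 (2 * R), 0 < z.im → s z ≤ ε / z.im ^ 2) :
    ∀ z ∈ Icc (x₀ - R) (x₀ + R) ×ℂ Icc 0 (2 * R), z.re = x₀ → s z ≤ 288 * ε / R ^ 2 := by
  set B := Icc (x₀ - R) (x₀ + R) ×ℂ Icc 0 (2 * R) with hB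
  have hBc : IsCompact B := isCompact_Icc.reProdIm isCompact_Icc
  intro z hz hzx
  by_contra! hlt
  -- The weight vanishes on the vertical sides. At a maximum `z₀` of the weighted function, `s` is
  -- comparable to `s z₀` at all points horizontally close to `z₀` on the scale `d`.
  have hcd : ContinuousOn (fun p : ℂ => s p * (R - |p.re - x₀|) ^ 2) B :=
    hc.mul (Continuous.continuousOn (by fun_prop))
  obtain ⟨z₀, hz₀, hmax⟩ := hBc.exists_isMaxOn ⟨z, hz⟩ hcd
  set d := R - |z₀.re - x₀| with hd
  set M := s z₀ with hM
  have hm : 288 * ε < M * d ^ 2 := by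
    have h1 := hmax hz
    simp only [mem_ofPred_eq, hzx, sub_self, abs_zero, sub_zero] at h1
    rw [div_lt_iff₀ (by positivity)] at hlt
    exact hlt.trans_le h1
  have hd0 : 0 ≤ d := by
    have h1 := hz₀.1
    simp only [mem_preimage, mem_Icc] at h1
    rw [hd, sub_nonneg, abs_le]; constructor <;> linarith
  have hM0 : 0 < M := by
    by_contra! h
    nlinarith [sq_nonneg d]
  have hdpos : 0 < d := by
    rcases hd0.eq_or_lt with h | h
    · rw [← h] at hm; nlinarith
    · exact h
  have hdR : d ≤ R := by rw [hd]; linarith [abs_nonneg (z₀.re - x₀)]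
  -- At height `n` the growth bound is exactly `M / 2`, so `z₀` lies below that height; `288 = 2 *
  -- 12 ^ 2` makes `12 * n < d`.
  obtain ⟨n, hn0, hn⟩ : ∃ n : ℝ, 0 < n ∧ n ^ 2 = 2 * ε / M :=
    ⟨√(2 * ε / M), Real.sqrt_pos.2 (by positivity), Real.sq_sqrt (by positivity)⟩
  have hnM : M * n ^ 2 = 2 * ε := by rw [hn]; field_simp
  have hnd : 12 * n < d := by
    have : (12 * n) ^ 2 < d ^ 2 := by
      have : M * (12 * n) ^ 2 < M * d ^ 2 := by nlinarith
      exact lt_of_mul_lt_mul_left this hM0.le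
    exact lt_of_pow_lt_pow_left₀ 2 hd0 this
  have hy0 : 0 < z₀.im := by
    have h1 := hz₀.2
    simp only [mem_preimage, mem_Icc] at h1
    rcases h1.1.eq_or_lt with h | h
    · exact absurd (hbot z₀ hz₀ h.symm) hM0.ne'
    · exact h
  have hy1 : z₀.im < n := by
    have h1 := hgrowth z₀ hz₀ hy0
    rw [le_div_iff₀ (by positivity)] at h1
    have h2 : M * z₀.im ^ 2 < M * n ^ 2 := by linarith
    exact lt_of_pow_lt_pow_left₀ 2 hn0.le (lt_of_mul_lt_mul_left h2 hM0.le)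
  -- The harmonic barrier `h` is at least `M / 2` on the rectangle `K`, which covers the top edge,
  -- and at least `2 * M` on its vertical sides, where `s < 2 * M`. At `z₀` it is at most `M / 2 + 2
  -- * M / 9 < M`, contradicting `s ≤ h`.
  set c := 2 * M / (9 * n ^ 2) with hcdef
  have hcn : c * (9 * n ^ 2) = 2 * M := by rw [hcdef]; field_simp
  have hcpos : 0 < c := by positivity
  set h : ℂ → ℝ := fun p => M / 2 + c * ((p.re - z₀.re) ^ 2 - p.im ^ 2 + n ^ 2) with hh
  set K := Icc (z₀.re - 3 * n) (z₀.re + 3 * n) ×ℂ Icc 0 n with hK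
  have hdist : ∀ p ∈ K, d - 3 * n ≤ R - |p.re - x₀| := by
    intro p hp
    have h1 := hp.1
    simp only [mem_preimage, mem_Icc] at h1
    have : |p.re - x₀| ≤ |z₀.re - x₀| + 3 * n := by
      calc |p.re - x₀| = |(p.re - z₀.re) + (z₀.re - x₀)| := by ring_nf
        _ ≤ |p.re - z₀.re| + |z₀.re - x₀| := abs_add_le _ _
        _ ≤ 3 * n + |z₀.re - x₀| := by
          gcongr; rw [abs_le]; constructor <;> linarith
        _ = _ := by ring
    linarith
  have hKB : K ⊆ B := by
    intro p hp
    have h1 := hdist p hp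
    have h2 := hp.2
    simp only [mem_preimage, mem_Icc] at h2
    have h3 : |p.re - x₀| ≤ R := by linarith
    rw [abs_le] at h3
    exact ⟨⟨by linarith, by linarith⟩, ⟨h2.1, by linarith⟩⟩
  have hup : ∀ p ∈ K, s p < 2 * M := by
    intro p hp
    have h1 := hmax (hKB hp)
    simp only [mem_ofPred_eq] at h1
    have h2 := hdist p hp
    -- From `12 * n < d`, moving by `3 * n` costs at most a quarter of `d`; then `(4 / 3) ^ 2 < 2`
    -- gives `s < 2 * M`.
    have h3 : (3 / 4 * d) ^ 2 ≤ (R - |p.re - x₀|) ^ 2 := by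
      gcongr; linarith
    by_contra! h4
    have : 2 * M * (3 / 4 * d) ^ 2 ≤ M * d ^ 2 :=
      (mul_le_mul h4 h3 (by positivity) (by linarith)).trans h1
    nlinarith [mul_pos hM0 (pow_pos hdpos 2)]
  have hneg : ∀ p ∈ K, s p - h p ≤ 0 := by
    refine nonpos_of_locallyReAt_of_pos (isCompact_Icc.reProdIm isCompact_Icc)
      ((hc.mono hKB).sub (Continuous.continuousOn (by fun_prop))) fun p hp hpos => ?_
    have h1 := hp.1
    have h2 := hp.2
    simp only [mem_preimage, mem_Icc] at h1 h2
    have hnn : p.im ^ 2 ≤ n ^ 2 := by gcongr; exact h2.1; exact h2.2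
    have hh0 : M / 2 ≤ h p := by
      have : 0 ≤ (p.re - z₀.re) ^ 2 - p.im ^ 2 + n ^ 2 := by nlinarith [sq_nonneg (p.re - z₀.re)]
      simp only [hh]; nlinarith
    have hsp : 0 < s p := by linarith
    constructor
    · have him : 0 < p.im := by
        rcases h2.1.eq_or_lt with h | h
        · exact absurd (hbot p (hKB hp) h.symm) hsp.ne'
        · exact h
      have hside : (p.re - z₀.re) ^ 2 ≠ (3 * n) ^ 2 := by
        intro heq
        have : 2 * M ≤ h p := by
          simp only [hh, heq]
          nlinarith
        linarith [hup p hp]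
      have h1' : z₀.re - 3 * n ≠ p.re := fun e => hside (by rw [← e]; ring)
      have h2' : p.re ≠ z₀.re + 3 * n := fun e => hside (by rw [e]; ring)
      have h3' : p.im ≠ n := by
        intro e
        have := hgrowth p (hKB hp) him
        rw [e, hn] at this
        have e2 : ε / (2 * ε / M) = M / 2 := by field_simp
        linarith
      exact reProdIm_Icc_mem_nhds (lt_of_le_of_ne h1.1 h1') (lt_of_le_of_ne h1.2 h2') him
        (lt_of_le_of_ne h2.2 h3')
    · refine (hharm p (hKB hp) hsp).sub_re
        (H := fun q => (M / 2 : ℝ) + (c : ℂ) * ((q - (z₀.re : ℂ)) ^ 2 + ((n ^ 2 : ℝ) : ℂ))) ?_ ?_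
      · exact Differentiable.analyticAt (by fun_prop) p
      · refine Eventually.of_forall fun q => ?_
        simp only [hh, Complex.add_re, Complex.ofReal_re, sq,
          Complex.mul_re, Complex.sub_re, Complex.sub_im, Complex.ofReal_im]
        ring
  have hz₀K : z₀ ∈ K := ⟨⟨by linarith, by linarith⟩, ⟨hy0.le, hy1.le⟩⟩
  have h1 := hneg z₀ hz₀K
  have h2 : h z₀ ≤ M / 2 + c * n ^ 2 := by
    simp only [hh, sub_self]
    nlinarith [sq_nonneg z₀.im, mul_nonneg hcpos.le (sq_nonneg z₀.im)]
  nlinarith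

/-! ### A Phragmén–Lindelöf principle for half strips -/

theorem LocallyReAt.continuousAt {g : ℂ → ℝ} {z : ℂ} (hg : LocallyReAt g z) :
    ContinuousAt g z := by
  obtain ⟨H, hH, hgH⟩ := hg
  have : ContinuousAt (fun p => (H p).re) z :=
    Complex.continuous_re.continuousAt.comp hH.continuousAt
  exact this.congr (hgH.mono fun p hp => hp.symm)

theorem re_I_div_sq (w : ℂ) :
    (Complex.I / w ^ 2).re = 2 * w.re * w.im / (w.re ^ 2 + w.im ^ 2) ^ 2 := by
  have : Complex.normSq (w ^ 2) = (w.re ^ 2 + w.im ^ 2) ^ 2 := by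
    rw [map_pow, Complex.normSq_apply]; ring
  rw [Complex.div_re, this]
  simp [sq]
  ring

theorem two_mul_div_sq_le {X Y : ℝ} (hY : 0 < Y) {y : ℝ} (hy : 0 < y) (hyY : y ≤ Y) :
    2 * X * Y / (X ^ 2 + Y ^ 2) ^ 2 ≤ 1 / y ^ 2 := by
  have h1 : y ^ 2 ≤ X ^ 2 + Y ^ 2 := by nlinarith [sq_nonneg X]
  have h2 : 0 < X ^ 2 + Y ^ 2 := by positivity
  calc 2 * X * Y / (X ^ 2 + Y ^ 2) ^ 2 ≤ (X ^ 2 + Y ^ 2) / (X ^ 2 + Y ^ 2) ^ 2 := by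
        gcongr; nlinarith [sq_nonneg (X - Y)]
    _ = 1 / (X ^ 2 + Y ^ 2) := by field_simp
    _ ≤ 1 / y ^ 2 := by gcongr

theorem le_two_mul_div_sq {X Y t : ℝ} (ht : 0 < t) (hX : t ≤ X) (hX' : X ≤ 2 * t)
    (hY : t ≤ Y) (hY' : Y ≤ 2 * t) : 1 / (32 * t ^ 2) ≤ 2 * X * Y / (X ^ 2 + Y ^ 2) ^ 2 := by
  have h1 : X ^ 2 + Y ^ 2 ≤ 8 * t ^ 2 := by nlinarith
  have h2 : 2 * t * t ≤ 2 * X * Y := by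
    have := mul_le_mul hX hY ht.le (ht.le.trans hX)
    nlinarith
  have h3 : 0 < X ^ 2 + Y ^ 2 := by nlinarith
  have h4 : 0 ≤ 2 * X * Y := le_trans (by positivity) h2
  calc 1 / (32 * t ^ 2) = 2 * t * t / (8 * t ^ 2) ^ 2 := by field_simp; norm_num
    _ ≤ _ := by gcongr

/-- The base is controlled except at the corners `a` and `b`. There, growth `o(y⁻²)` is beaten by
small multiples of `± Re (i / (z - p) ^ 2)`, harmonic functions of the critical order with poles `p`
just outside the strip. The linear term `C * (z.im / Y)` absorbs the excess on the top edge, and `C`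
does not depend on the width of the strip. -/
theorem le_add_of_halfStrip {W : ℂ → ℝ} {a b Y η C : ℝ} (hY : 0 < Y) (hη : 0 ≤ η)
    (hC : 0 ≤ C) (hW : ∀ z : ℂ, 0 < z.im → LocallyReAt W z)
    (hgrowth : ∀ ε > 0, ∃ Y' > 0, ∀ z : ℂ, 0 < z.im → z.im < Y' → W z ≤ ε / z.im ^ 2)
    (hleft : ∀ z : ℂ, z.re = a → 0 < z.im → z.im ≤ Y → W z ≤ η)
    (hright : ∀ z : ℂ, z.re = b → 0 < z.im → z.im ≤ Y → W z ≤ η)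
    (htop : ∀ z : ℂ, a < z.re → z.re < b → z.im = Y → W z ≤ η + C)
    (hbot : ∀ x : ℝ, a < x → x < b → ∀ η' > η, ∀ᶠ z : ℂ in 𝓝 (x : ℂ), 0 < z.im → W z ≤ η') :
    ∀ z : ℂ, a < z.re → z.re < b → 0 < z.im → z.im ≤ Y → W z ≤ η + C * (z.im / Y) := by
  intro z₀ ha0 hb0 hy0 hyY
  have hab : a < b := ha0.trans hb0
  suffices H : ∀ η' > η, W z₀ - η' ≤ C * (z₀.im / Y) by
    refine le_of_forall_pos_le_add fun δ hδ => ?_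
    linarith [H (η + δ) (by linarith)]
  intro η' hη'
  classical
  -- Because `η' > η`, the truncation vanishes near the open base and the sides, so its extension by
  -- zero is continuous at heights up to `Y` except perhaps at the two corners.
  set s : ℂ → ℝ := fun z => if a < z.re ∧ z.re < b ∧ 0 < z.im then max (W z - η') 0 else 0 with hs
  have hs_in : ∀ z : ℂ, a < z.re → z.re < b → 0 < z.im → s z = max (W z - η') 0 :=
    fun z h1 h2 h3 => if_pos ⟨h1, h2, h3⟩
  have hs_in_ev : ∀ z : ℂ, a < z.re → z.re < b → 0 < z.im →
      ∀ᶠ p in 𝓝 z, s p = max (W p - η') 0 := by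
    intro z h1 h2 h3
    filter_upwards [Complex.continuous_re.continuousAt.eventually_const_lt h1,
      Complex.continuous_re.continuousAt.eventually_lt_const h2,
      Complex.continuous_im.continuousAt.eventually_const_lt h3] with p h1 h2 h3
    exact hs_in p h1 h2 h3
  have hs_pos : ∀ z : ℂ, 0 < s z → (a < z.re ∧ z.re < b ∧ 0 < z.im) ∧ 0 < W z - η' := by
    intro z hz
    by_cases h : a < z.re ∧ z.re < b ∧ 0 < z.im
    · refine ⟨h, ?_⟩
      rw [hs_in z h.1 h.2.1 h.2.2] at hz
      simpa using hz
    · simp only [hs, if_neg h, lt_irrefl] at hz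
  have hs_zero : ∀ z : ℂ, (∀ᶠ p in 𝓝 z, 0 < p.im → a < p.re → p.re < b → W p ≤ η') →
      ContinuousAt s z := by
    intro z hz
    have : ∀ᶠ p in 𝓝 z, s p = 0 := by
      filter_upwards [hz] with p hp
      by_cases h : a < p.re ∧ p.re < b ∧ 0 < p.im
      · rw [hs_in p h.1 h.2.1 h.2.2]
        exact max_eq_right (by linarith [hp h.2.2 h.1 h.2.1])
      · simp only [hs, if_neg h]
    exact (continuousAt_const (y := (0 : ℝ))).congr (this.mono fun p hp => hp.symm)
  have hs_cont : ∀ z : ℂ, z.im ≤ Y → z ≠ a → z ≠ b → ContinuousAt s z := by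
    intro z hzY hza hzb
    rcases lt_or_ge z.im 0 with h | him
    · refine hs_zero z ?_
      filter_upwards [Complex.continuous_im.continuousAt.eventually_lt_const h] with p hp hp'
      linarith
    rcases lt_or_ge z.re a with h | hra
    · refine hs_zero z ?_
      filter_upwards [Complex.continuous_re.continuousAt.eventually_lt_const h] with p hp _ hp'
      linarith
    rcases lt_or_ge b z.re with h | hrb
    · refine hs_zero z ?_
      filter_upwards [Complex.continuous_re.continuousAt.eventually_const_lt h] with p hp _ _ hp'
      linarith
    rcases him.eq_or_lt with h | him
    · have hz : z = (z.re : ℂ) := by apply Complex.ext <;> simp [← h]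
      have h1 : a < z.re := lt_of_le_of_ne hra fun e => hza (by rw [hz, e])
      have h2 : z.re < b := lt_of_le_of_ne hrb fun e => hzb (by rw [hz, e])
      refine hs_zero z ?_
      rw [hz]
      filter_upwards [hbot z.re h1 h2 η' hη'] with p hp hp' _ _
      exact hp hp'
    · have hcont := (hW z him).continuousAt
      rcases hra.eq_or_lt with h | hra
      · refine hs_zero z ?_
        filter_upwards [hcont.eventually_lt_const
          (lt_of_le_of_lt (hleft z h.symm him hzY) hη')] with p hp _ _ _
        exact hp.le
      rcases hrb.eq_or_lt with h | hrb
      · refine hs_zero z ?_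
        filter_upwards [hcont.eventually_lt_const
          (lt_of_le_of_lt (hright z h him hzY) hη')] with p hp _ _ _
        exact hp.le
      have : ContinuousAt (fun p => max (W p - η') 0) z :=
        (hcont.sub continuousAt_const).max continuousAt_const
      exact this.congr ((hs_in_ev z hra hrb him).mono fun p hp => hp.symm)
  have hs_harm : ∀ z : ℂ, 0 < s z → LocallyReAt s z := by
    intro z hz
    obtain ⟨⟨h1, h2, h3⟩, h4⟩ := hs_pos z hz
    obtain ⟨G, hG, hG'⟩ := (hW z h3).sub_re (h := fun _ => η') (H := fun _ => (η' : ℂ))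
      analyticAt_const (Eventually.of_forall fun _ => by simp)
    refine ⟨G, hG, ?_⟩
    have hcont : ContinuousAt (fun p => W p - η') z :=
      (hW z h3).continuousAt.sub continuousAt_const
    filter_upwards [hs_in_ev z h1 h2 h3, hcont.eventually_const_lt h4, hG'] with p h5 h6 h7
    rw [h5, max_eq_left h6.le, h7]
  have hs_nonpos_im : ∀ z : ℂ, z.im = 0 → s z = 0 := by
    intro z hz
    simp [hs, hz]
  suffices H : ∀ ε > 0, s z₀ ≤ C * (z₀.im / Y) + ε by
    have h1 := le_of_forall_pos_le_add H
    have h2 := hs_in z₀ ha0 hb0 hy0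
    have h3 : W z₀ - η' ≤ s z₀ := h2 ▸ le_max_left _ _
    exact h3.trans h1
  intro ε₀ hε₀
  -- `ε` is chosen so that the two barriers together contribute at most `ε₀` at the fixed point
  -- `z₀`, whatever the later value of `τ`.
  obtain ⟨ε, hε, hεε⟩ : ∃ ε > 0, 2 * (36864 * ε) * (1 / z₀.im ^ 2) = ε₀ :=
    ⟨ε₀ * z₀.im ^ 2 / 73728, by positivity, by field_simp; norm_num⟩
  obtain ⟨Y', hY', hg⟩ := hgrowth ε hε
  have hs_growth : ∀ z : ℂ, 0 < z.im → z.im < Y' → s z ≤ ε / z.im ^ 2 := by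
    intro z h1 h2
    by_contra! h3
    have h4 : 0 < s z := lt_of_le_of_lt (by positivity) h3
    obtain ⟨⟨h5, h6, -⟩, h7⟩ := hs_pos z h4
    rw [hs_in z h5 h6 h1, max_eq_left h7.le] at h3
    linarith [hg z h1 h2]
  obtain ⟨τ, hτ0, hτ1, hτ2, hτ3⟩ : ∃ τ > 0, τ < Y' ∧ τ ≤ z₀.im ∧ 2 * τ ≤ b - a := by
    refine ⟨min (Y' / 2) (min z₀.im ((b - a) / 2)), ?_, ?_, ?_, ?_⟩
    · exact lt_min (by linarith) (lt_min hy0 (by linarith))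
    · exact lt_of_le_of_lt (min_le_left _ _) (by linarith)
    · exact (min_le_right _ _).trans (min_le_left _ _)
    · have : min (Y' / 2) (min z₀.im ((b - a) / 2)) ≤ (b - a) / 2 :=
        (min_le_right _ _).trans (min_le_right _ _)
      linarith
  -- The Domar estimate with `R = τ / 2`, on boxes that stay away from the corners; `288 * 4 =
  -- 1152`.
  have hdomar : ∀ x₀ : ℝ, a + τ ≤ x₀ → x₀ ≤ b - τ → ∀ z : ℂ, z.re = x₀ → 0 ≤ z.im → z.im ≤ τ →
      s z ≤ 1152 * ε / τ ^ 2 := by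
    intro x₀ hx1 hx2 z hz h0 h1
    have h2 := le_of_le_div_im_sq (s := s) (x₀ := x₀) (R := τ / 2) (ε := ε) (by positivity) hε
      (fun p hp => by
        have h1 := hp.1
        have h2 := hp.2
        simp only [mem_preimage, mem_Icc] at h1 h2
        refine (hs_cont p (by linarith) ?_ ?_).continuousWithinAt
        · rintro rfl
          simp at h1; linarith
        · rintro rfl
          simp at h1; linarith)
      (fun p _ hp => hs_nonpos_im p hp) (fun p _ hp => hs_harm p hp)
      (fun p hp hp' => by
        have h2 := hp.2
        simp only [mem_preimage, mem_Icc] at h2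
        exact hs_growth p hp' (by linarith)) z
      ⟨⟨by linarith, by linarith⟩, ⟨h0, by linarith⟩⟩ hz
    calc s z ≤ 288 * ε / (τ / 2) ^ 2 := h2
      _ = _ := by field_simp; norm_num
  have hedge : ∀ z : ℂ, 0 < z.im → z.im = τ → s z ≤ 1152 * ε / τ ^ 2 := by
    intro z h0 h1
    have := hs_growth z h0 (by linarith)
    rw [h1] at this
    refine this.trans ?_
    gcongr
    linarith
  -- Seen from `p₁`, the points of the corner square of side `τ` at `a` have both coordinates in
  -- `[τ, 2τ]`, where the kernel is at least `1 / (32 * τ ^ 2)`; and `36864 = 32 * 1152` matches the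
  -- Domar bound. The barrier at `p₂` enters with a minus sign because the horizontal coordinate is
  -- negative there.
  set p₁ : ℂ := ⟨a - τ, -τ⟩ with hp₁
  set p₂ : ℂ := ⟨b + τ, -τ⟩ with hp₂
  set h : ℂ → ℝ := fun z => C * (z.im / Y) + 36864 * ε * (Complex.I / (z - p₁) ^ 2).re
    - 36864 * ε * (Complex.I / (z - p₂) ^ 2).re with hh
  have hB₁ : ∀ z : ℂ, (Complex.I / (z - p₁) ^ 2).re =
      2 * (z.re - a + τ) * (z.im + τ) / ((z.re - a + τ) ^ 2 + (z.im + τ) ^ 2) ^ 2 := by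
    intro z
    rw [re_I_div_sq]; simp only [hp₁, Complex.sub_re, Complex.sub_im]; ring_nf
  have hB₂ : ∀ z : ℂ, -(Complex.I / (z - p₂) ^ 2).re =
      2 * (b - z.re + τ) * (z.im + τ) / ((b - z.re + τ) ^ 2 + (z.im + τ) ^ 2) ^ 2 := by
    intro z
    rw [re_I_div_sq]; simp only [hp₂, Complex.sub_re, Complex.sub_im]
    rw [← neg_div]
    ring_nf
  -- The strip without the two corner squares. On their inner vertical edges `s` is bounded by
  -- `hdomar`, on their top edges by `hedge`.
  set K : Set ℂ := (Icc a b ×ℂ Icc 0 Y) ∩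
    ({z | τ ≤ z.re - a ∨ τ ≤ z.im} ∩ {z | τ ≤ b - z.re ∨ τ ≤ z.im}) with hK
  have hKc : IsCompact K := by
    refine (isCompact_Icc.reProdIm isCompact_Icc).inter_right (IsClosed.inter ?_ ?_)
    · exact (isClosed_le continuous_const (by fun_prop : Continuous fun z : ℂ => z.re - a)).union
        (isClosed_le continuous_const Complex.continuous_im)
    · exact (isClosed_le continuous_const (by fun_prop : Continuous fun z : ℂ => b - z.re)).union
        (isClosed_le continuous_const Complex.continuous_im)
  have hne : ∀ z : ℂ, 0 ≤ z.im → z - p₁ ≠ 0 ∧ z - p₂ ≠ 0 := by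
    intro z hz
    constructor
    · intro e
      have := congrArg Complex.im e
      simp [hp₁] at this; linarith
    · intro e
      have := congrArg Complex.im e
      simp [hp₂] at this; linarith
  have hmax : ∀ z ∈ K, s z - h z ≤ 0 := by
    refine nonpos_of_locallyReAt_of_pos hKc (ContinuousOn.sub ?_ ?_) ?_
    · rintro z ⟨⟨h1, h2⟩, h3, h4⟩
      simp only [mem_preimage, mem_Icc, mem_ofPred_eq] at h1 h2 h3 h4
      refine (hs_cont z h2.2 ?_ ?_).continuousWithinAt
      · rintro rfl
        linarith [show τ ≤ 0 by simpa using h3]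
      · rintro rfl
        linarith [show τ ≤ 0 by simpa using h4]
    · have h1 : ∀ p : ℂ, (∀ z ∈ K, z - p ≠ 0) →
          ContinuousOn (fun z => 36864 * ε * (Complex.I / (z - p) ^ 2).re) K := by
        intro p hp
        refine continuousOn_const.mul (Complex.continuous_re.comp_continuousOn ?_)
        exact continuousOn_const.div (by fun_prop) fun z hz => pow_ne_zero 2 (hp z hz)
      refine (ContinuousOn.add (by fun_prop) (h1 p₁ ?_)).sub (h1 p₂ ?_)
      · rintro z ⟨⟨-, h2⟩, -⟩
        exact (hne z h2.1).1
      · rintro z ⟨⟨-, h2⟩, -⟩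
        exact (hne z h2.1).2
    · rintro z ⟨⟨h1, h2⟩, h3, h4⟩ hpos
      simp only [mem_preimage, mem_Icc, mem_ofPred_eq] at h1 h2 h3 h4
      have hb1 : 0 ≤ (Complex.I / (z - p₁) ^ 2).re := by
        rw [hB₁]
        have : 0 ≤ z.re - a := by linarith
        have := h2.1
        positivity
      have hb2 : 0 ≤ -(Complex.I / (z - p₂) ^ 2).re := by
        rw [hB₂]
        have : 0 ≤ b - z.re := by linarith
        have := h2.1
        positivity
      have hc0 : 0 ≤ C * (z.im / Y) := mul_nonneg hC (div_nonneg h2.1 hY.le)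
      have hm1 : 0 ≤ 36864 * ε * (Complex.I / (z - p₁) ^ 2).re := by positivity
      have hm2 : 0 ≤ 36864 * ε * -(Complex.I / (z - p₂) ^ 2).re := by positivity
      have hge1 : C * (z.im / Y) ≤ h z := by simp only [hh]; linarith
      have hge2 : 36864 * ε * (Complex.I / (z - p₁) ^ 2).re ≤ h z := by
        simp only [hh]; linarith
      have hge3 : 36864 * ε * -(Complex.I / (z - p₂) ^ 2).re ≤ h z := by
        simp only [hh]; linarith
      have hsz : 0 < s z := by linarith
      obtain ⟨⟨hra, hrb, him⟩, hWz⟩ := hs_pos z hsz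
      have hcorner : ∀ B : ℝ, 1 / (32 * τ ^ 2) ≤ B → 1152 * ε / τ ^ 2 ≤ 36864 * ε * B := by
        intro B hB
        calc 1152 * ε / τ ^ 2 = 36864 * ε * (1 / (32 * τ ^ 2)) := by field_simp; norm_num
          _ ≤ _ := by gcongr
      have ha' : τ < z.re - a ∨ τ < z.im := by
        by_contra! hcon
        have hB := hcorner _ (hB₁ z ▸ le_two_mul_div_sq hτ0 (by linarith) (by linarith)
          (by linarith) (by linarith))
        rcases h3 with h3 | h3
        · linarith [hdomar z.re (by linarith) (by linarith) z rfl h2.1 hcon.2]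
        · linarith [hedge z him (le_antisymm hcon.2 h3)]
      have hb' : τ < b - z.re ∨ τ < z.im := by
        by_contra! hcon
        have hB := hcorner _ (hB₂ z ▸ le_two_mul_div_sq hτ0 (by linarith) (by linarith)
          (by linarith) (by linarith))
        rcases h4 with h4 | h4
        · linarith [hdomar z.re (by linarith) (by linarith) z rfl h2.1 hcon.2]
        · linarith [hedge z him (le_antisymm hcon.2 h4)]
      have htop' : z.im < Y := by
        refine lt_of_le_of_ne h2.2 fun e => ?_
        have h5 := htop z hra hrb e
        have h6 : s z ≤ C := by
          rw [hs_in z hra hrb him]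
          exact max_le (by linarith) hC
        rw [e, div_self hY.ne'] at hge1
        linarith
      constructor
      · refine inter_mem (reProdIm_Icc_mem_nhds hra hrb him htop') (inter_mem ?_ ?_)
        · rcases ha' with h | h
          · have h' : τ + a < z.re := by linarith
            filter_upwards [Complex.continuous_re.continuousAt.eventually_const_lt h'] with p hp
            exact Or.inl (by linarith)
          · filter_upwards [Complex.continuous_im.continuousAt.eventually_const_lt h] with p hp
            exact Or.inr hp.le
        · rcases hb' with h | h
          · have h' : z.re < b - τ := by linarith
            filter_upwards [Complex.continuous_re.continuousAt.eventually_lt_const h'] with p hp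
            exact Or.inl (by linarith)
          · filter_upwards [Complex.continuous_im.continuousAt.eventually_const_lt h] with p hp
            exact Or.inr hp.le
      · have han : ∀ p : ℂ, z - p ≠ 0 → AnalyticAt ℂ (fun q => Complex.I / (q - p) ^ 2) z := by
          intro p hp
          exact analyticAt_const.div ((analyticAt_id.sub analyticAt_const).pow 2)
            (pow_ne_zero 2 hp)
        refine (hs_harm z hsz).sub_re
          (H := fun q => ((C / Y : ℝ) : ℂ) * (-Complex.I * q)
            + ((36864 * ε : ℝ) : ℂ) * (Complex.I / (q - p₁) ^ 2)
            - ((36864 * ε : ℝ) : ℂ) * (Complex.I / (q - p₂) ^ 2)) ?_ ?_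
        · refine AnalyticAt.sub (AnalyticAt.add (Differentiable.analyticAt (by fun_prop) z) ?_) ?_
          · exact analyticAt_const.mul (han p₁ (hne z h2.1).1)
          · exact analyticAt_const.mul (han p₂ (hne z h2.1).2)
        · refine Eventually.of_forall fun q => ?_
          simp only [hh, Complex.add_re, Complex.sub_re, Complex.re_ofReal_mul]
          simp
          ring
  have hfin := hmax z₀ ⟨⟨⟨ha0.le, hb0.le⟩, ⟨hy0.le, hyY⟩⟩, Or.inr hτ2, Or.inr hτ2⟩
  have e1 : (Complex.I / (z₀ - p₁) ^ 2).re ≤ 1 / z₀.im ^ 2 := by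
    rw [hB₁]; exact two_mul_div_sq_le (by positivity) hy0 (by linarith)
  have e2 : -(Complex.I / (z₀ - p₂) ^ 2).re ≤ 1 / z₀.im ^ 2 := by
    rw [hB₂]; exact two_mul_div_sq_le (by positivity) hy0 (by linarith)
  have e3 := mul_le_mul_of_nonneg_left e1 (show 0 ≤ 36864 * ε by positivity)
  have e4 := mul_le_mul_of_nonneg_left e2 (show 0 ≤ 36864 * ε by positivity)
  simp only [hh] at hfin
  linarith

/-! ### Radial control implies unrestricted control -/

theorem exists_bound_of_forall_ge_sSup {Z' : Set ℝ} (hZ : IsClosed Z') {α β x : ℝ}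
    (hα : α ∈ Z') (hβ : β ∈ Z') (hαx : α ≤ x) (hxβ : x ≤ β) (hx : x ∉ Z') :
    ∃ a ∈ Z', ∃ b ∈ Z', α ≤ a ∧ b ≤ β ∧ a < x ∧ x < b ∧ ∀ t, a < t → t < b → t ∉ Z' := by
  have h1 : IsCompact (Z' ∩ Icc α x) := isCompact_Icc.inter_left hZ
  have h2 : IsCompact (Z' ∩ Icc x β) := isCompact_Icc.inter_left hZ
  obtain ⟨a, ha, hamax⟩ := h1.exists_isMaxOn ⟨α, hα, le_rfl, hαx⟩ continuousOn_id
  obtain ⟨b, hb, hbmin⟩ := h2.exists_isMinOn ⟨β, hβ, hxβ, le_rfl⟩ continuousOn_id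
  refine ⟨a, ha.1, b, hb.1, ha.2.1, hb.2.2, lt_of_le_of_ne ha.2.2 fun e => hx (e ▸ ha.1),
    lt_of_le_of_ne hb.2.1 fun e => hx (e ▸ hb.1), fun t h1 h2 ht => ?_⟩
  rcases le_total t x with h | h
  · exact absurd (hamax (show t ∈ Z' ∩ Icc α x from ⟨ht, ha.2.1.trans h1.le, h⟩)) (not_le.2 h1)
  · exact absurd (hbmin (show t ∈ Z' ∩ Icc x β from ⟨ht, h, h2.le.trans hb.2.2⟩)) (not_le.2 h2)

/-- A Baire category argument on the closed set `Z` of points without a neighbourhood of controlled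
boundary points: a relatively open portion of `Z` with uniform radial control turns out to be
controlled. -/
theorem eventually_le_of_forall_radial_le {W : ℂ → ℝ} (hW : ∀ z : ℂ, 0 < z.im → LocallyReAt W z)
    (hgrowth : ∀ ε > 0, ∃ Y' > 0, ∀ z : ℂ, 0 < z.im → z.im < Y' → W z ≤ ε / z.im ^ 2)
    (hrad : ∀ x : ℝ, ∀ η > 0, ∀ᶠ y in 𝓝[>] (0 : ℝ), W ⟨x, y⟩ ≤ η) :
    ∀ η > 0, ∀ x : ℝ, ∀ᶠ z in 𝓝 (x : ℂ), 0 < z.im → W z ≤ η := by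
  suffices H : ∀ η > 0, ∀ x : ℝ, ∀ η' > η, ∀ᶠ z in 𝓝 (x : ℂ), 0 < z.im → W z ≤ η' from
    fun η hη x => H (η / 2) (by linarith) x η (by linarith)
  intro η hη
  have hrad' : ∀ x : ℝ, ∃ δ > 0, ∀ y, 0 < y → y ≤ δ → W ⟨x, y⟩ ≤ η := by
    intro x
    obtain ⟨δ, hδ, h⟩ := mem_nhdsGT_iff_exists_Ioc_subset.1 (hrad x η hη)
    exact ⟨δ, hδ, fun y h1 h2 => h ⟨h1, h2⟩⟩
  have hWx : ∀ y > 0, Continuous fun x : ℝ => W ⟨x, y⟩ := by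
    intro y hy
    rw [continuous_iff_continuousAt]
    intro x
    have h1 : ContinuousAt (fun x : ℝ => (⟨x, y⟩ : ℂ)) x := by
      have : (fun x : ℝ => (⟨x, y⟩ : ℂ)) = fun x : ℝ => (x : ℂ) + y * Complex.I := by
        funext x; apply Complex.ext <;> simp
      rw [this]; fun_prop
    exact ContinuousAt.comp (f := fun x : ℝ => (⟨x, y⟩ : ℂ)) (g := W)
      (hW ⟨x, y⟩ hy).continuousAt h1
  set S : Set ℝ := {x | ∀ η' > η, ∀ᶠ z in 𝓝 (x : ℂ), 0 < z.im → W z ≤ η'} with hS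
  set Z : Set ℝ := (interior S)ᶜ with hZ
  have hZc : IsClosed Z := isOpen_interior.isClosed_compl
  suffices hempty : Z = ∅ by
    intro x
    have : x ∈ interior S := by
      by_contra h
      exact (hempty ▸ (show x ∈ Z from h) : x ∈ (∅ : Set ℝ))
    exact interior_subset this
  by_contra hne
  have hne' : Nonempty Z := (nonempty_iff_ne_empty.2 hne).to_subtype
  have : CompleteSpace Z := hZc.completeSpace_coe
  let A : ℕ → Set Z := fun n => {x | ∀ y : ℝ, 0 < y → y ≤ 1 / (n + 1) → W ⟨x, y⟩ ≤ η}
  have hAc : ∀ n, IsClosed (A n) := by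
    intro n
    simp only [A, ofPred_forall]
    refine isClosed_iInter fun y => isClosed_iInter fun hy => isClosed_iInter fun _ => ?_
    exact isClosed_le ((hWx y hy).comp continuous_subtype_val) continuous_const
  have hAU : ⋃ n, A n = univ := by
    refine eq_univ_of_forall fun x => ?_
    obtain ⟨δ, hδ, h⟩ := hrad' x
    obtain ⟨n, hn⟩ := exists_nat_one_div_lt hδ
    exact mem_iUnion.2 ⟨n, fun y h1 h2 => h y h1 (h2.trans hn.le)⟩
  -- Baire in the complete space `Z`: near `x₀`, the bound `W ≤ η` holds above all points of `Z` up
  -- to the common height `1 / (n + 1)`.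
  obtain ⟨n, ⟨x₀, hx₀Z⟩, hx₀⟩ := nonempty_interior_of_iUnion_of_closed hAc hAU
  obtain ⟨ρ, hρ, hball⟩ := Metric.mem_nhds_iff.1 (mem_interior_iff_mem_nhds.1 hx₀)
  set α := x₀ - ρ / 2 with hα
  set β := x₀ + ρ / 2 with hβ
  have hαβ : ∀ x, x ∈ Z → α ≤ x → x ≤ β → ∀ y : ℝ, 0 < y → y ≤ 1 / (n + 1) → W ⟨x, y⟩ ≤ η := by
    intro x hx h1 h2
    have hm : (⟨x, hx⟩ : Z) ∈ Metric.ball (⟨x₀, hx₀Z⟩ : Z) ρ := by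
      rw [Metric.mem_ball, Subtype.dist_eq, Real.dist_eq, abs_lt]
      constructor <;> linarith
    exact hball hm
  obtain ⟨δ₁, hδ₁, h₁⟩ := hrad' α
  obtain ⟨δ₂, hδ₂, h₂⟩ := hrad' β
  set Y := min (1 / ((n : ℝ) + 1)) (min δ₁ δ₂) with hY
  have hYpos : 0 < Y := lt_min (by positivity) (lt_min hδ₁ hδ₂)
  have hY0 : Y ≤ 1 / ((n : ℝ) + 1) := min_le_left _ _
  have hY1 : Y ≤ δ₁ := (min_le_right _ _).trans (min_le_left _ _)
  have hY2 : Y ≤ δ₂ := (min_le_right _ _).trans (min_le_right _ _)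
  -- Adding the endpoints places every point of `[α, β]` outside `Z'` in a bounded gap whose ends
  -- still carry the radial bound, up to height `Y`.
  set Z' : Set ℝ := (Z ∩ Icc α β) ∪ {α, β} with hZ'
  have hZ'c : IsClosed Z' := (hZc.inter isClosed_Icc).union ((finite_singleton β).insert α).isClosed
  have hZ'W : ∀ x ∈ Z', ∀ y : ℝ, 0 < y → y ≤ Y → W ⟨x, y⟩ ≤ η := by
    rintro x (⟨h1, h2, h3⟩ | h | h) y hy hyY
    · exact hαβ x h1 h2 h3 y hy (hyY.trans hY0)
    · rw [h]; exact h₁ y hy (hyY.trans hY1)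
    · rw [mem_singleton_iff.1 h]; exact h₂ y hy (hyY.trans hY2)
  -- A single `C` for the segment at height `Y` over all of `[α, β]`, so that the half-strip
  -- estimate is uniform over the gaps.
  obtain ⟨C, hC⟩ := (isCompact_Icc (a := α) (b := β)).exists_bound_of_continuousOn
    (hWx Y hYpos).continuousOn
  have hC0 : 0 ≤ C := (norm_nonneg _).trans (hC α ⟨le_rfl, by linarith⟩)
  have hmain : ∀ z : ℂ, α < z.re → z.re < β → 0 < z.im → z.im ≤ Y → W z ≤ η + C * (z.im / Y) := by
    intro z hz1 hz2 hz3 hz4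
    by_cases hz : z.re ∈ Z'
    · have h1 : W z ≤ η := hZ'W z.re hz z.im hz3 hz4
      have h2 : 0 ≤ C * (z.im / Y) := by positivity
      linarith
    obtain ⟨a, ha, b, hb, hαa, hbβ, hax, hxb, hgap⟩ := exists_bound_of_forall_ge_sSup hZ'c
      (show α ∈ Z' by simp [hZ']) (show β ∈ Z' by simp [hZ']) hz1.le hz2.le hz
    refine le_add_of_halfStrip (a := a) (b := b) hYpos hη.le hC0 hW hgrowth
      (fun p h1 h2 h3 => ?_) (fun p h1 h2 h3 => ?_) (fun p h1 h2 h3 => ?_)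
      (fun x h1 h2 => ?_) z hax hxb hz3 hz4
    · exact hZ'W p.re (h1 ▸ ha) p.im h2 h3
    · exact hZ'W p.re (h1 ▸ hb) p.im h2 h3
    · have h4 : |W ⟨p.re, Y⟩| ≤ C := hC p.re ⟨by linarith, by linarith⟩
      have h5 : W p ≤ C := by
        have : p = ⟨p.re, Y⟩ := Complex.ext rfl h3
        rw [this]; exact (abs_le.1 h4).2
      linarith
    · have h3 : x ∉ Z := fun hx => hgap x h1 h2 (Or.inl ⟨hx, by linarith, by linarith⟩)
      have h4 : x ∈ interior S := not_not.1 h3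
      exact interior_subset h4
  have hsub : Ioo α β ⊆ S := by
    intro x hx η' hη'
    have h1 : 0 < (η' - η) * Y / (C + 1) := by
      have : 0 < η' - η := by linarith
      positivity
    filter_upwards [Complex.continuous_re.continuousAt.eventually_const_lt
        (show α < (x : ℂ).re from hx.1),
      Complex.continuous_re.continuousAt.eventually_lt_const (show (x : ℂ).re < β from hx.2),
      Complex.continuous_im.continuousAt.eventually_lt_const (show (x : ℂ).im < Y by simpa),
      Complex.continuous_im.continuousAt.eventually_lt_const
        (show (x : ℂ).im < (η' - η) * Y / (C + 1) by simpa)] with z h2 h3 h4 h5 h6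
    refine (hmain z h2 h3 h6 h4.le).trans ?_
    rw [lt_div_iff₀ (by positivity)] at h5
    have h7 : C * (z.im / Y) ≤ η' - η := by
      rw [mul_div_assoc', div_le_iff₀ hYpos]
      nlinarith
    linarith
  exact hx₀Z (interior_maximal hsub isOpen_Ioo ⟨by linarith, by linarith⟩)

/-! ### A maximum principle on the disc with radial boundary limits -/

theorem LocallyReAt.comp {g : ℂ → ℝ} {φ : ℂ → ℂ} {z : ℂ} (hg : LocallyReAt g (φ z))
    (hφ : AnalyticAt ℂ φ z) : LocallyReAt (fun p => g (φ p)) z := by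
  obtain ⟨H, hH, hgH⟩ := hg
  exact ⟨fun p => H (φ p), hH.comp hφ, hφ.continuousAt.eventually hgH⟩

theorem norm_exp_I_mul (ζ : ℂ) : ‖Complex.exp (Complex.I * ζ)‖ = Real.exp (-ζ.im) := by
  rw [Complex.norm_exp]; simp

theorem half_le_one_sub_exp_neg {y : ℝ} (h0 : 0 ≤ y) (h1 : y ≤ 1) : y / 2 ≤ 1 - Real.exp (-y) := by
  have h2 : (1 + y) * Real.exp (-y) ≤ 1 := by
    have := mul_le_mul_of_nonneg_right (Real.add_one_le_exp y) (Real.exp_pos (-y)).le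
    rw [← Real.exp_add] at this
    simp at this; linarith
  nlinarith [Real.exp_pos (-y)]

/-- The map `ζ ↦ exp (i ζ)` carries the upper half plane into the disc and vertical lines to radii,
with `1 - |z|` comparable to the height near the boundary. Unrestricted control at each boundary
point becomes uniform by compactness, and the ordinary maximum principle on a smaller disc finishes.
-/
theorem nonpos_of_forall_radial_limsup_nonpos {w : ℂ → ℝ}
    (hw : ∀ z : ℂ, ‖z‖ < 1 → LocallyReAt w z)
    (hgrowth : ∀ ε > 0, ∃ ρ < 1, ∀ z : ℂ, ρ < ‖z‖ → ‖z‖ < 1 → w z ≤ ε / (1 - ‖z‖) ^ 2)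
    (hrad : ∀ θ ∈ Ico (-Real.pi) Real.pi, ∀ η > 0, ∀ᶠ r : ℝ in 𝓝[<] 1,
      w ((r : ℂ) * Complex.exp ((θ : ℂ) * Complex.I)) ≤ η) :
    ∀ z : ℂ, ‖z‖ < 1 → w z ≤ 0 := by
  set W : ℂ → ℝ := fun ζ => w (Complex.exp (Complex.I * ζ)) with hWdef
  have hlt : ∀ ζ : ℂ, 0 < ζ.im → ‖Complex.exp (Complex.I * ζ)‖ < 1 := by
    intro ζ h
    rw [norm_exp_I_mul]; exact Real.exp_lt_one_iff.2 (by linarith)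
  have hW : ∀ ζ : ℂ, 0 < ζ.im → LocallyReAt W ζ := fun ζ h =>
    (hw _ (hlt ζ h)).comp (φ := fun ζ => Complex.exp (Complex.I * ζ))
      (Differentiable.analyticAt (by fun_prop) ζ)
  have hWg : ∀ ε > 0, ∃ Y' > 0, ∀ z : ℂ, 0 < z.im → z.im < Y' → W z ≤ ε / z.im ^ 2 := by
    intro ε hε
    obtain ⟨ρ, hρ, h⟩ := hgrowth (ε / 4) (by positivity)
    have h1 : ∀ᶠ y : ℝ in 𝓝 0, ρ < Real.exp (-y) :=
      (Continuous.continuousAt (by fun_prop)).eventually_const_lt (by simpa using hρ)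
    obtain ⟨δ, hδ, h2⟩ := Metric.eventually_nhds_iff.1 h1
    refine ⟨min δ 1, lt_min hδ one_pos, fun z hz1 hz2 => ?_⟩
    have h3 : ρ < Real.exp (-z.im) := h2 (by
      rw [Real.dist_eq, sub_zero, abs_of_pos hz1]; exact hz2.trans_le (min_le_left _ _))
    have h4 := half_le_one_sub_exp_neg hz1.le (hz2.le.trans (min_le_right _ _))
    refine (h _ (by rwa [norm_exp_I_mul]) (hlt z hz1)).trans ?_
    rw [norm_exp_I_mul]
    calc ε / 4 / (1 - Real.exp (-z.im)) ^ 2 ≤ ε / 4 / (z.im / 2) ^ 2 := by gcongr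
      _ = ε / z.im ^ 2 := by field_simp; norm_num
  have hWr : ∀ x : ℝ, ∀ η > 0, ∀ᶠ y in 𝓝[>] (0 : ℝ), W ⟨x, y⟩ ≤ η := by
    intro x η hη
    set θ := toIcoMod Real.two_pi_pos (-Real.pi) x with hθ
    have hθm : θ ∈ Ico (-Real.pi) Real.pi := by
      have := toIcoMod_mem_Ico Real.two_pi_pos (-Real.pi) x
      rwa [show -Real.pi + 2 * Real.pi = Real.pi by ring] at this
    have hx : x = θ + toIcoDiv Real.two_pi_pos (-Real.pi) x * (2 * Real.pi) := by
      have := toIcoMod_add_toIcoDiv_zsmul Real.two_pi_pos (-Real.pi) x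
      rw [zsmul_eq_mul] at this
      exact this.symm
    have h1 : Tendsto (fun y : ℝ => Real.exp (-y)) (𝓝[>] 0) (𝓝[<] 1) := by
      refine tendsto_nhdsWithin_iff.2 ⟨?_, ?_⟩
      · have : Tendsto (fun y : ℝ => Real.exp (-y)) (𝓝 0) (𝓝 (Real.exp (-0))) :=
          Continuous.tendsto (by fun_prop) 0
        simpa using this.mono_left nhdsWithin_le_nhds
      · filter_upwards [self_mem_nhdsWithin] with y hy
        exact Real.exp_lt_one_iff.2 (neg_lt_zero.2 hy)
    filter_upwards [h1.eventually (hrad θ hθm η hη)] with y hy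
    convert hy using 1
    simp only [hWdef]
    congr 1
    rw [Complex.ofReal_exp, ← Complex.exp_add, Complex.exp_eq_exp_iff_exists_int]
    refine ⟨toIcoDiv Real.two_pi_pos (-Real.pi) x, ?_⟩
    have h2 : (⟨x, y⟩ : ℂ) = x + y * Complex.I := by apply Complex.ext <;> simp
    have h3 : (x : ℂ) = θ + toIcoDiv Real.two_pi_pos (-Real.pi) x * (2 * Real.pi) := by
      conv_lhs => rw [hx]
      push_cast; ring
    rw [h2, h3]
    push_cast
    linear_combination (y : ℂ) * Complex.I_sq
  have key := eventually_le_of_forall_radial_le hW hWg hWr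
  intro z₀ hz₀
  refine le_of_forall_pos_le_add fun η hη => ?_
  rw [zero_add]
  obtain ⟨δ, hδ, hunif⟩ : ∃ δ > 0, ∀ x ∈ Icc (-Real.pi) Real.pi, ∀ y : ℝ, 0 < y → y < δ →
      W ⟨x, y⟩ ≤ η := by
    refine (isCompact_Icc (a := -Real.pi) (b := Real.pi)).induction_on
      (p := fun S => ∃ δ > 0, ∀ x ∈ S, ∀ y : ℝ, 0 < y → y < δ → W ⟨x, y⟩ ≤ η) ?_ ?_ ?_ ?_
    · exact ⟨1, one_pos, fun x hx => hx.elim⟩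
    · rintro S T hST ⟨δ, hδ, h⟩
      exact ⟨δ, hδ, fun x hx => h x (hST hx)⟩
    · rintro S T ⟨δ, hδ, h⟩ ⟨δ', hδ', h'⟩
      refine ⟨min δ δ', lt_min hδ hδ', ?_⟩
      rintro x (hx | hx) y hy hy'
      · exact h x hx y hy (hy'.trans_le (min_le_left _ _))
      · exact h' x hx y hy (hy'.trans_le (min_le_right _ _))
    · intro x _
      obtain ⟨δ, hδ, h⟩ := Metric.eventually_nhds_iff.1 (key η hη x)
      refine ⟨Ioo (x - δ / 2) (x + δ / 2),
        mem_nhdsWithin_of_mem_nhds (Ioo_mem_nhds (by linarith) (by linarith)), δ / 2,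
        by linarith, fun t ht y hy hy' => h ?_ hy⟩
      rw [dist_eq_norm]
      refine (Complex.norm_le_abs_re_add_abs_im _).trans_lt ?_
      have h1 : |t - x| < δ / 2 := by rw [abs_lt]; constructor <;> linarith [ht.1, ht.2]
      simp only [Complex.sub_re, Complex.sub_im, Complex.ofReal_re, Complex.ofReal_im, sub_zero,
        abs_of_pos hy]
      linarith
  have hnear : ∀ z : ℂ, Real.exp (-δ) < ‖z‖ → ‖z‖ < 1 → w z ≤ η := by
    intro z h1 h2
    have hz : 0 < ‖z‖ := (Real.exp_pos _).trans h1
    have h3 : Complex.exp (Complex.I * ⟨z.arg, -Real.log ‖z‖⟩) = z := by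
      have h4 : Complex.I * (⟨z.arg, -Real.log ‖z‖⟩ : ℂ) = Complex.log z := by
        apply Complex.ext <;> simp [Complex.log_re, Complex.log_im]
      rw [h4, Complex.exp_log (norm_pos_iff.1 hz)]
    have h4 := hunif z.arg ⟨(Complex.neg_pi_lt_arg z).le, Complex.arg_le_pi z⟩ (-Real.log ‖z‖)
      (by linarith [Real.log_neg hz h2]) (by
        have := (Real.lt_log_iff_exp_lt hz).2 h1
        linarith)
    simp only [hWdef, h3] at h4
    exact h4
  obtain ⟨ρ, hρ1, hρ2⟩ := exists_between
    (max_lt (Real.exp_lt_one_iff.2 (neg_lt_zero.2 hδ)) hz₀ : max (Real.exp (-δ)) ‖z₀‖ < 1)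
  have hfin := nonpos_of_locallyReAt_of_pos (isCompact_closedBall (0 : ℂ) ρ)
    (g := fun z => w z - η) ?_ ?_ z₀ (by
      rw [mem_closedBall_zero_iff]; exact (le_max_right _ _).trans hρ1.le)
  · linarith
  · intro z hz
    rw [mem_closedBall_zero_iff] at hz
    exact ((hw z (hz.trans_lt hρ2)).continuousAt.sub continuousAt_const).continuousWithinAt
  · intro z hz hpos
    rw [mem_closedBall_zero_iff] at hz
    have hz1 := hz.trans_lt hρ2
    constructor
    · have h1 : ‖z‖ < ρ := by
        refine lt_of_le_of_ne hz fun e => ?_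
        have := hnear z (by rw [e]; exact (le_max_left _ _).trans_lt hρ1) hz1
        linarith
      exact mem_of_superset (Metric.isOpen_ball.mem_nhds (mem_ball_zero_iff.2 h1))
        Metric.ball_subset_closedBall
    · exact (hw z hz1).sub_re (h := fun _ => η) (H := fun _ => (η : ℂ)) analyticAt_const
        (Eventually.of_forall fun _ => by simp)

/-! ### The Poisson kernel -/

theorem poissonDenom_pos {r : ℝ} (hr0 : 0 ≤ r) (hr1 : r < 1) (t : ℝ) :
    0 < 1 - 2 * r * Real.cos t + r ^ 2 := by
  nlinarith [Real.cos_le_one t, mul_le_mul_of_nonneg_left (Real.cos_le_one t) hr0,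
    sq_pos_of_pos (sub_pos.2 hr1)]

theorem sq_one_sub_le_poissonDenom {r : ℝ} (hr0 : 0 ≤ r) (t : ℝ) :
    (1 - r) ^ 2 ≤ 1 - 2 * r * Real.cos t + r ^ 2 := by
  nlinarith [mul_le_mul_of_nonneg_left (Real.cos_le_one t) hr0]

/-- The derivative of the Poisson kernel in the angular variable. -/
def poissonKerDeriv (r t : ℝ) : ℝ :=
  -((1 - r ^ 2) * (2 * r * Real.sin t)) /
    (2 * Real.pi * (1 - 2 * r * Real.cos t + r ^ 2) ^ 2)

theorem hasDerivAt_poissonKer {r : ℝ} (hr0 : 0 ≤ r) (hr1 : r < 1) (t : ℝ) :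
    HasDerivAt (poissonKer r) (poissonKerDeriv r t) t := by
  have hD := poissonDenom_pos hr0 hr1 t
  have h1 : HasDerivAt (fun t => 2 * Real.pi * (1 - 2 * r * Real.cos t + r ^ 2))
      (2 * Real.pi * (2 * r * Real.sin t)) t :=
    (((((Real.hasDerivAt_cos t).const_mul (2 * r)).const_sub 1).add_const
      (r ^ 2)).const_mul (2 * Real.pi)).congr_deriv (by ring)
  refine ((hasDerivAt_const t (1 - r ^ 2)).fun_div h1 (by positivity)).congr_deriv ?_
  unfold poissonKerDeriv
  have := Real.pi_pos
  field_simp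
  ring

theorem continuous_poissonKer {r : ℝ} (hr0 : 0 ≤ r) (hr1 : r < 1) : Continuous (poissonKer r) :=
  continuous_iff_continuousAt.2 fun t => (hasDerivAt_poissonKer hr0 hr1 t).continuousAt

theorem continuous_poissonKerDeriv {r : ℝ} (hr0 : 0 ≤ r) (hr1 : r < 1) :
    Continuous (poissonKerDeriv r) := by
  unfold poissonKerDeriv
  refine Continuous.div (by fun_prop) (by fun_prop) fun t => ?_
  have := poissonDenom_pos hr0 hr1 t
  have := Real.pi_pos
  positivity

theorem poissonKer_periodic (r : ℝ) : Function.Periodic (poissonKer r) (2 * Real.pi) := by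
  intro t; simp [poissonKer]

theorem poissonKerDeriv_periodic (r : ℝ) :
    Function.Periodic (poissonKerDeriv r) (2 * Real.pi) := by
  intro t; simp [poissonKerDeriv]

theorem poissonKer_neg (r t : ℝ) : poissonKer r (-t) = poissonKer r t := by
  simp [poissonKer]

theorem poissonKerDeriv_neg (r t : ℝ) : poissonKerDeriv r (-t) = -poissonKerDeriv r t := by
  simp [poissonKerDeriv, neg_div]

theorem poissonKer_pos {r : ℝ} (hr0 : 0 ≤ r) (hr1 : r < 1) (t : ℝ) : 0 < poissonKer r t := by
  have := poissonDenom_pos hr0 hr1 t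
  have := Real.pi_pos
  have : 0 < 1 - r ^ 2 := by nlinarith
  unfold poissonKer
  positivity

theorem poissonKer_le {r : ℝ} (hr0 : 0 ≤ r) (hr1 : r < 1) (t : ℝ) :
    poissonKer r t ≤ 1 / (1 - r) := by
  have h1 : 0 < 1 - r := by linarith
  have h2 : (1 : ℝ) ≤ Real.pi := by linarith [Real.pi_gt_three]
  have h3 := sq_one_sub_le_poissonDenom hr0 t
  calc poissonKer r t ≤ 2 * (1 - r) / (2 * 1 * (1 - r) ^ 2) := by
        unfold poissonKer
        gcongr
        nlinarith
    _ = 1 / (1 - r) := by field_simp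

theorem poissonKerDeriv_nonpos {r : ℝ} (hr0 : 0 ≤ r) (hr1 : r < 1) {t : ℝ} (h0 : 0 ≤ t)
    (hpi : t ≤ Real.pi) : poissonKerDeriv r t ≤ 0 := by
  have := poissonDenom_pos hr0 hr1 t
  have := Real.pi_pos
  have : 0 ≤ 1 - r ^ 2 := by nlinarith
  have := Real.sin_nonneg_of_nonneg_of_le_pi h0 hpi
  unfold poissonKerDeriv
  rw [neg_div, neg_nonpos]
  positivity

theorem abs_poissonKerDeriv {r : ℝ} (hr0 : 0 ≤ r) (hr1 : r < 1) (t : ℝ) :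
    |poissonKerDeriv r t| = (1 - r ^ 2) * |2 * r * Real.sin t| /
      (2 * Real.pi * (1 - 2 * r * Real.cos t + r ^ 2) ^ 2) := by
  have h1 : 0 ≤ 1 - r ^ 2 := by nlinarith
  have h2 : 0 ≤ 2 * Real.pi * (1 - 2 * r * Real.cos t + r ^ 2) ^ 2 := by
    have := Real.pi_pos
    positivity
  rw [poissonKerDeriv, abs_div, abs_neg, abs_of_nonneg h2, abs_mul, abs_of_nonneg h1]

/-- With `D = (1 - r)² + 2r(1 - cos t)`, it comes from `2(1 - r)|sin t| ≤ (1 - r)² + sin² t` and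
`sin² t ≤ 2(1 - cos t)`. Since the kernel has mass one, the derivative has `L¹` norm at most `1 / (1
- r)`. -/
theorem abs_poissonKerDeriv_le {r : ℝ} (hr0 : 0 ≤ r) (hr1 : r < 1) (t : ℝ) :
    |poissonKerDeriv r t| ≤ poissonKer r t / (1 - r) := by
  have hD := poissonDenom_pos hr0 hr1 t
  have hpi := Real.pi_pos
  have h1 : 0 < 1 - r := by linarith
  have h2 : 0 < 1 - r ^ 2 := by nlinarith
  have key : |2 * r * Real.sin t| ≤ (1 - 2 * r * Real.cos t + r ^ 2) / (1 - r) := by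
    rw [le_div_iff₀ h1, abs_mul, abs_of_nonneg (by linarith : 0 ≤ 2 * r)]
    have h3 : |Real.sin t| ^ 2 ≤ 2 * (1 - Real.cos t) := by
      rw [sq_abs]; nlinarith [Real.sin_sq_add_cos_sq t, sq_nonneg (1 - Real.cos t)]
    nlinarith [mul_le_mul_of_nonneg_left h3 hr0,
      mul_nonneg hr0 (sq_nonneg (1 - r - |Real.sin t|)), mul_nonneg h1.le (sq_nonneg (1 - r))]
  rw [abs_poissonKerDeriv hr0 hr1]
  calc (1 - r ^ 2) * |2 * r * Real.sin t| / (2 * Real.pi * (1 - 2 * r * Real.cos t + r ^ 2) ^ 2)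
      ≤ (1 - r ^ 2) * ((1 - 2 * r * Real.cos t + r ^ 2) / (1 - r)) /
        (2 * Real.pi * (1 - 2 * r * Real.cos t + r ^ 2) ^ 2) := by gcongr
    _ = poissonKer r t / (1 - r) := by unfold poissonKer; field_simp

theorem poissonKer_le_of_le {r δ t : ℝ} (hr0 : 1 / 2 ≤ r) (hr1 : r < 1) (hδ0 : 0 < δ)
    (hδt : δ ≤ t) (ht : t ≤ Real.pi) :
    poissonKer r t ≤ (1 - r) / (1 - Real.cos δ) ∧
      |poissonKerDeriv r t| ≤ 2 * (1 - r) / (1 - Real.cos δ) ^ 2 := by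
  have hpi := Real.pi_gt_three
  have hcos : Real.cos t ≤ Real.cos δ := Real.cos_le_cos_of_nonneg_of_le_pi hδ0.le ht hδt
  have hc1 : Real.cos δ < 1 := by
    have := Real.cos_lt_cos_of_nonneg_of_le_pi le_rfl (hδt.trans ht) hδ0
    simpa using this
  have hκ : 0 < 1 - Real.cos δ := by linarith
  have hD : 1 - Real.cos δ ≤ 1 - 2 * r * Real.cos t + r ^ 2 := by
    nlinarith [sq_nonneg (1 - r), mul_le_mul_of_nonneg_left hcos (show 0 ≤ r by linarith)]
  have h0 : 0 < 1 - r := by linarith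
  have h1 : 0 ≤ 1 - r ^ 2 := by nlinarith
  have h2 : 1 - r ^ 2 ≤ 2 * (1 - r) := by nlinarith
  constructor
  · calc poissonKer r t ≤ 2 * (1 - r) / (2 * 1 * (1 - Real.cos δ)) := by
          unfold poissonKer
          gcongr
          linarith
      _ = _ := by field_simp
  · have hs : |2 * r * Real.sin t| ≤ 2 := by
      rw [abs_mul, abs_of_nonneg (by linarith : 0 ≤ 2 * r)]
      nlinarith [Real.abs_sin_le_one t, abs_nonneg (Real.sin t)]
    rw [abs_poissonKerDeriv (by linarith) hr1]
    calc (1 - r ^ 2) * |2 * r * Real.sin t| /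
          (2 * Real.pi * (1 - 2 * r * Real.cos t + r ^ 2) ^ 2)
        ≤ 2 * (1 - r) * 2 / (2 * 1 * (1 - Real.cos δ) ^ 2) := by
          gcongr
          linarith
      _ = _ := by field_simp

theorem poissonKernel_eq_poissonKer (R r θ φ : ℝ) (hR : 0 < R) :
    poissonKernel 0 ((r : ℂ) * Complex.exp (θ * Complex.I)) (circleMap 0 R φ) =
      2 * Real.pi * poissonKer (r / R) (φ - θ) := by
  have h1 : ‖circleMap 0 R φ - (r : ℂ) * Complex.exp (θ * Complex.I)‖ ^ 2 =
      R ^ 2 - 2 * R * r * Real.cos (φ - θ) + r ^ 2 := by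
    rw [← Complex.normSq_eq_norm_sq, Complex.normSq_apply, Real.cos_sub]
    simp only [circleMap, zero_add, Complex.sub_re, Complex.sub_im, Complex.re_ofReal_mul,
      Complex.im_ofReal_mul, Complex.exp_ofReal_mul_I_re, Complex.exp_ofReal_mul_I_im]
    linear_combination R ^ 2 * Real.sin_sq_add_cos_sq φ + r ^ 2 * Real.sin_sq_add_cos_sq θ
  rw [poissonKernel_def]
  simp only [sub_zero, h1]
  have hpi := Real.pi_pos
  have h2 : ‖(r : ℂ) * Complex.exp (θ * Complex.I)‖ ^ 2 = r ^ 2 := by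
    rw [norm_mul, Complex.norm_exp_ofReal_mul_I]; simp
  have h3 : ‖circleMap 0 R φ‖ ^ 2 = R ^ 2 := by
    simp
  rw [h2, h3]
  unfold poissonKer
  have : R ^ 2 - 2 * R * r * Real.cos (φ - θ) + r ^ 2 =
    R ^ 2 * (1 - 2 * (r / R) * Real.cos (φ - θ) + (r / R) ^ 2) := by field_simp
  rw [this]
  by_cases h0 : 1 - 2 * (r / R) * Real.cos (φ - θ) + (r / R) ^ 2 = 0
  · simp [h0]
  · field_simp

/-- The Poisson integral formula in polar coordinates. -/
theorem eq_integral_poissonKer {u : ℂ → ℝ} {R r θ : ℝ}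
    (hu : InnerProductSpace.HarmonicOnNhd u (Metric.closedBall 0 R)) (hr0 : 0 ≤ r) (hr : r < R) :
    u ((r : ℂ) * Complex.exp (θ * Complex.I)) =
      ∫ φ in (0 : ℝ)..2 * Real.pi, poissonKer (r / R) (φ - θ) * u (circleMap 0 R φ) := by
  have hw : (r : ℂ) * Complex.exp (θ * Complex.I) ∈ Metric.ball (0 : ℂ) R := by
    rw [mem_ball_zero_iff, norm_mul, Complex.norm_exp_ofReal_mul_I]
    simpa [abs_of_nonneg hr0] using hr
  rw [← hu.circleAverage_poissonKernel_smul hw, Real.circleAverage, smul_eq_mul,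
    ← intervalIntegral.integral_const_mul]
  refine intervalIntegral.integral_congr fun φ _ => ?_
  simp only [Pi.smul_apply', smul_eq_mul, poissonKernel_eq_poissonKer R r θ φ (hr0.trans_lt hr)]
  have := Real.pi_pos
  field_simp

theorem integral_poissonKer {r : ℝ} (hr0 : 0 ≤ r) (hr1 : r < 1) (a : ℝ) :
    ∫ t in a..(a + 2 * Real.pi), poissonKer r t = 1 := by
  have h := eq_integral_poissonKer (u := fun _ => 1) (R := 1) (r := r) (θ := 0)
    (InnerProductSpace.harmonicOnNhd_const 1) hr0 hr1
  rw [(poissonKer_periodic r).intervalIntegral_add_eq a 0]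
  simpa using h.symm

/-! ### Poisson–Stieltjes integrals -/

/-- The Poisson integral of `dN` over `[α, β]`, integrated by parts. -/
def poissonStieltjes (N : ℝ → ℝ) (α β r θ : ℝ) : ℝ :=
  N β * poissonKer r (β - θ) - N α * poissonKer r (α - θ) -
    ∫ φ in α..β, N φ * poissonKerDeriv r (φ - θ)

/-- The holomorphic kernel whose real part is the Poisson kernel. -/
def holKer (φ : ℝ) (z : ℂ) : ℂ :=
  (2 * Real.pi : ℝ)⁻¹ * ((Complex.exp (φ * Complex.I) + z) / (Complex.exp (φ * Complex.I) - z))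

/-- The derivative of `holKer` in the angular variable. -/
def holKerDeriv (φ : ℝ) (z : ℂ) : ℂ :=
  (2 * Real.pi : ℝ)⁻¹ * (-2 * Complex.I * Complex.exp (φ * Complex.I) * z /
    (Complex.exp (φ * Complex.I) - z) ^ 2)

theorem one_sub_norm_le_norm_exp_sub (φ : ℝ) (z : ℂ) :
    1 - ‖z‖ ≤ ‖Complex.exp (φ * Complex.I) - z‖ := by
  have := norm_sub_norm_le (Complex.exp (φ * Complex.I)) z
  rwa [Complex.norm_exp_ofReal_mul_I] at this

theorem exp_sub_ne_zero (φ : ℝ) {z : ℂ} (hz : ‖z‖ < 1) : Complex.exp (φ * Complex.I) - z ≠ 0 := by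
  rw [← norm_pos_iff]
  linarith [one_sub_norm_le_norm_exp_sub φ z]

theorem norm_mul_exp_lt_one {r : ℝ} (hr0 : 0 ≤ r) (hr1 : r < 1) (θ : ℝ) :
    ‖(r : ℂ) * Complex.exp (θ * Complex.I)‖ < 1 := by
  rw [norm_mul, Complex.norm_exp_ofReal_mul_I]
  simpa [abs_of_nonneg hr0] using hr1

theorem holKer_re (r θ φ : ℝ) :
    (holKer φ ((r : ℂ) * Complex.exp (θ * Complex.I))).re = poissonKer r (φ - θ) := by
  have h1 := poissonKernel_eq_poissonKer 1 r θ φ one_pos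
  rw [poissonKernel_eq_re_herglotzRieszKernel, Function.comp, herglotzRieszKernel_def] at h1
  simp only [circleMap, sub_zero, zero_add, Complex.ofReal_one, one_mul, div_one] at h1
  rw [holKer, Complex.re_ofReal_mul, h1]
  have := Real.pi_pos
  field_simp

theorem hasDerivAt_holKer {z : ℂ} (hz : ‖z‖ < 1) (φ : ℝ) :
    HasDerivAt (fun φ : ℝ => holKer φ z) (holKerDeriv φ z) φ := by
  have h1 : HasDerivAt (fun φ : ℝ => Complex.exp (φ * Complex.I))
      (Complex.exp (φ * Complex.I) * (1 * Complex.I)) φ :=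
    ((Complex.ofRealCLM.hasDerivAt (x := φ)).mul_const Complex.I).cexp
  refine (((h1.add_const z).fun_div (h1.sub_const z) (exp_sub_ne_zero φ hz)).const_mul
    (((2 * Real.pi : ℝ)⁻¹ : ℝ) : ℂ)).congr_deriv ?_ |>.congr_of_eventuallyEq ?_
  · unfold holKerDeriv
    push_cast
    ring
  · refine Eventually.of_forall fun t => ?_
    simp [holKer]

theorem holKerDeriv_re {r : ℝ} (hr0 : 0 ≤ r) (hr1 : r < 1) (θ φ : ℝ) :
    (holKerDeriv φ ((r : ℂ) * Complex.exp (θ * Complex.I))).re = poissonKerDeriv r (φ - θ) := by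
  have h1 := hasDerivAt_holKer (norm_mul_exp_lt_one hr0 hr1 θ) φ
  have h2 : HasDerivAt (fun φ : ℝ => (holKer φ ((r : ℂ) * Complex.exp (θ * Complex.I))).re)
      (holKerDeriv φ ((r : ℂ) * Complex.exp (θ * Complex.I))).re φ :=
    (Complex.reCLM.hasFDerivAt.comp_hasDerivAt φ h1)
  have h3 : HasDerivAt (fun φ : ℝ => poissonKer r (φ - θ)) (poissonKerDeriv r (φ - θ)) φ :=
    (hasDerivAt_poissonKer hr0 hr1 (φ - θ)).comp_sub_const φ θ
  simp only [holKer_re] at h2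
  exact h2.unique h3

theorem continuous_holKerDeriv {z : ℂ} (hz : ‖z‖ < 1) :
    Continuous fun φ : ℝ => holKerDeriv φ z := by
  unfold holKerDeriv
  refine continuous_const.mul (Continuous.div (by fun_prop) (by fun_prop) fun φ => ?_)
  exact pow_ne_zero 2 (exp_sub_ne_zero φ hz)

theorem differentiableOn_integral_holKerDeriv {N : ℝ → ℝ} {α β : ℝ}
    (hN : IntervalIntegrable N MeasureTheory.volume α β) :
    DifferentiableOn ℂ (fun z => ∫ φ in α..β, (N φ : ℂ) * holKerDeriv φ z) (Metric.ball 0 1) := by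
  have hNc : IntervalIntegrable (fun φ => (N φ : ℂ)) MeasureTheory.volume α β :=
    ⟨hN.1.ofReal, hN.2.ofReal⟩
  intro z₀ hz₀
  rw [mem_ball_zero_iff] at hz₀
  obtain ⟨ρ, hρ1, hρ2⟩ := exists_between hz₀
  have hρ : ∀ z ∈ Metric.ball (0 : ℂ) ρ, ‖z‖ < 1 := fun z hz =>
    (mem_ball_zero_iff.1 hz).trans hρ2
  set D : ℂ → ℝ → ℂ := fun z φ => (2 * Real.pi : ℝ)⁻¹ *
    (-2 * Complex.I * Complex.exp (φ * Complex.I) * (Complex.exp (φ * Complex.I) + z) /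
      (Complex.exp (φ * Complex.I) - z) ^ 3) with hD
  have hDcont : Continuous fun φ : ℝ => D z₀ φ := by
    refine continuous_const.mul (Continuous.div (by fun_prop) (by fun_prop) fun φ => ?_)
    exact pow_ne_zero 3 (exp_sub_ne_zero φ hz₀)
  have hint : ∀ {g : ℝ → ℂ}, Continuous g →
      IntervalIntegrable (fun φ => (N φ : ℂ) * g φ) MeasureTheory.volume α β := fun hg =>
    hNc.mul_continuousOn hg.continuousOn
  have hbound : ∀ z ∈ Metric.ball (0 : ℂ) ρ, ∀ φ : ℝ, ‖D z φ‖ ≤ 4 / (1 - ρ) ^ 3 := by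
    intro z hz φ
    have h1 := one_sub_norm_le_norm_exp_sub φ z
    have h2 := mem_ball_zero_iff.1 hz
    have h3 : 0 < 1 - ρ := by linarith
    have h4 : ‖Complex.exp (φ * Complex.I) + z‖ ≤ 2 := by
      refine (norm_add_le _ _).trans ?_
      rw [Complex.norm_exp_ofReal_mul_I]; linarith
    have h5 : (2 * Real.pi)⁻¹ ≤ 1 := inv_le_one_of_one_le₀ (by linarith [Real.pi_gt_three])
    have hpi := Real.pi_pos
    simp only [hD, norm_mul, norm_div, norm_pow, Complex.norm_exp_ofReal_mul_I, Complex.norm_I,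
      norm_neg, Complex.norm_ofNat, Complex.norm_real, Real.norm_ofNat, mul_one, norm_inv]
    rw [Real.norm_of_nonneg hpi.le]
    calc (2 * Real.pi)⁻¹ * (2 * ‖Complex.exp (φ * Complex.I) + z‖ /
          ‖Complex.exp (φ * Complex.I) - z‖ ^ 3)
        ≤ 1 * (2 * 2 / (1 - ρ) ^ 3) := by
          gcongr
          linarith
      _ = 4 / (1 - ρ) ^ 3 := by ring
  refine DifferentiableAt.differentiableWithinAt (HasDerivAt.differentiableAt
    (intervalIntegral.hasDerivAt_integral_of_dominated_loc_of_deriv_le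
      (s := Metric.ball 0 ρ) (F := fun z φ => (N φ : ℂ) * holKerDeriv φ z)
      (F' := fun z φ => (N φ : ℂ) * D z φ) (bound := fun φ => ‖(N φ : ℂ)‖ * (4 / (1 - ρ) ^ 3))
      (Metric.isOpen_ball.mem_nhds (mem_ball_zero_iff.2 hρ1)) ?_ ?_ ?_ ?_ ?_ ?_).2)
  · filter_upwards [Metric.isOpen_ball.mem_nhds (mem_ball_zero_iff.2 hρ1)] with z hz
    exact (intervalIntegrable_iff.1 (hint (continuous_holKerDeriv (hρ z hz)))).aestronglyMeasurable
  · exact hint (continuous_holKerDeriv hz₀)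
  · exact (intervalIntegrable_iff.1 (hint hDcont)).aestronglyMeasurable
  · refine Eventually.of_forall fun φ _ z hz => ?_
    rw [norm_mul]
    exact mul_le_mul_of_nonneg_left (hbound z hz φ) (norm_nonneg _)
  · exact hNc.norm.mul_const _
  · refine Eventually.of_forall fun φ _ z hz => ?_
    have h0 := exp_sub_ne_zero φ (hρ z hz)
    have h1 : HasDerivAt (fun z : ℂ => (Complex.exp (φ * Complex.I) - z) ^ 2) _ z :=
      ((hasDerivAt_id z).const_sub (Complex.exp (φ * Complex.I))).fun_pow 2
    have h2 : HasDerivAt (fun z : ℂ => -2 * Complex.I * Complex.exp (φ * Complex.I) * z) _ z :=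
      (hasDerivAt_id z).const_mul (-2 * Complex.I * Complex.exp (φ * Complex.I))
    refine HasDerivAt.const_mul _ (HasDerivAt.const_mul _
      ((h2.fun_div h1 (pow_ne_zero 2 h0)).congr_deriv ?_))
    simp only [id]
    generalize Complex.exp (φ * Complex.I) = e at h0
    field_simp
    ring

/-- Harmonicity of Poisson–Stieltjes integrals, in the form that `LocallyReAt` needs. Only
integrability of `N` is assumed, because the monotone majorant may jump. -/
theorem exists_differentiableOn_re_eq_poissonStieltjes {N : ℝ → ℝ} {α β : ℝ}
    (hN : IntervalIntegrable N MeasureTheory.volume α β) :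
    ∃ H : ℂ → ℂ, DifferentiableOn ℂ H (Metric.ball 0 1) ∧ ∀ r θ : ℝ, 0 ≤ r → r < 1 →
      (H ((r : ℂ) * Complex.exp (θ * Complex.I))).re = poissonStieltjes N α β r θ := by
  refine ⟨fun z => N β * holKer β z - N α * holKer α z -
    ∫ φ in α..β, (N φ : ℂ) * holKerDeriv φ z, ?_, ?_⟩
  · have h1 : ∀ φ : ℝ, DifferentiableOn ℂ (holKer φ) (Metric.ball 0 1) := by
      intro φ
      refine DifferentiableOn.const_mul ?_ _
      exact DifferentiableOn.div (by fun_prop) (by fun_prop) fun z hz =>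
        exp_sub_ne_zero φ (mem_ball_zero_iff.1 hz)
    exact (((h1 β).const_mul _).sub ((h1 α).const_mul _)).sub
      (differentiableOn_integral_holKerDeriv hN)
  · intro r θ hr0 hr1
    have hz := norm_mul_exp_lt_one hr0 hr1 θ
    have hNc : IntervalIntegrable (fun φ => (N φ : ℂ)) MeasureTheory.volume α β :=
      ⟨hN.1.ofReal, hN.2.ofReal⟩
    have h1 := Complex.reCLM.intervalIntegral_comp_comm
      (hNc.mul_continuousOn (continuous_holKerDeriv hz).continuousOn)
    simp only [Complex.reCLM_apply, Complex.re_ofReal_mul, holKerDeriv_re hr0 hr1] at h1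
    rw [Complex.sub_re, Complex.sub_re, Complex.re_ofReal_mul, Complex.re_ofReal_mul, holKer_re,
      holKer_re, ← h1, poissonStieltjes]

/-! ### One-dimensional Henstock–Kurzweil integration -/

open BoxIntegral in
theorem ivl_lower_upper (J : Box (Fin 1)) : ivl (J.lower 0) (J.upper 0) (J.lower_lt_upper 0) = J := by
  have h1 : (fun _ : Fin 1 => J.lower 0) = J.lower := by
    funext i; rw [Subsingleton.elim i 0]
  have h2 : (fun _ : Fin 1 => J.upper 0) = J.upper := by
    funext i; rw [Subsingleton.elim i 0]
  cases J
  simp only [ivl] at *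
  congr

open BoxIntegral in
theorem hkIntegral_lower_upper (f : ℝ → ℝ) (J : Box (Fin 1)) :
    hkIntegral f (J.lower 0) (J.upper 0) =
      integral J IntegrationParams.Henstock (fun x : Fin 1 → ℝ => f (x 0)) BoxAdditiveMap.volume := by
  rw [hkIntegral, dif_pos (J.lower_lt_upper 0), ivl_lower_upper]

theorem hkIntegral_of_not_lt (f : ℝ → ℝ) {a b : ℝ} (h : ¬a < b) : hkIntegral f a b = 0 :=
  dif_neg h

theorem splitLower_ivl {a b c : ℝ} (hab : a < b) (hbc : b < c) :
    (ivl a c (hab.trans hbc)).splitLower 0 b = ivl a b hab := by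
  have h : b ∈ Ioo ((ivl a c (hab.trans hbc)).lower 0) ((ivl a c (hab.trans hbc)).upper 0) :=
    ⟨hab, hbc⟩
  rw [BoxIntegral.Box.splitLower_def h]
  congr 2
  funext i
  rw [Subsingleton.elim i 0, Function.update_self]

theorem splitUpper_ivl {a b c : ℝ} (hab : a < b) (hbc : b < c) :
    (ivl a c (hab.trans hbc)).splitUpper 0 b = ivl b c hbc := by
  have h : b ∈ Ioo ((ivl a c (hab.trans hbc)).lower 0) ((ivl a c (hab.trans hbc)).upper 0) :=
    ⟨hab, hbc⟩
  rw [BoxIntegral.Box.splitUpper_def h]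
  congr 2
  funext i
  rw [Subsingleton.elim i 0, Function.update_self]

theorem hkIntegral_add {f : ℝ → ℝ} {a b c : ℝ} (hab : a < b) (hbc : b < c)
    (hf : HKIntegrable f a c) : hkIntegral f a b + hkIntegral f b c = hkIntegral f a c := by
  obtain ⟨h, hi⟩ := hf
  have h1 := hi.toBoxAdditive.map_split_add le_rfl 0 b
  rw [splitLower_ivl hab hbc, splitUpper_ivl hab hbc] at h1
  rw [hkIntegral, dif_pos hab, hkIntegral, dif_pos hbc, hkIntegral, dif_pos h]
  exact h1

/-- The increment of `ψ` as a box-additive function. -/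
def incrementMap (ψ : ℝ → ℝ) : BoxIntegral.BoxAdditiveMap (Fin 1) ℝ ⊤ :=
  BoxIntegral.BoxAdditiveMap.ofMapSplitAdd (fun J => ψ (J.upper 0) - ψ (J.lower 0)) ⊤ (by
    intro I _ i x hx
    obtain rfl : i = 0 := Subsingleton.elim i 0
    have h1 := splitLower_ivl hx.1 hx.2
    have h2 := splitUpper_ivl hx.1 hx.2
    rw [ivl_lower_upper] at h1 h2
    rw [h1, h2]
    simp only [ivl]
    change (ψ x - ψ (I.lower 0)) + (ψ (I.upper 0) - ψ x) = _
    ring)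

theorem sum_increment {a b : ℝ} {h : a < b} (ψ : ℝ → ℝ)
    {π : BoxIntegral.TaggedPrepartition (ivl a b h)} (hπ : π.IsPartition) :
    ∑ J ∈ π.boxes, (ψ (J.upper 0) - ψ (J.lower 0)) = ψ b - ψ a :=
  (incrementMap ψ).sum_partition_boxes le_top hπ

/-- A primitive of a Henstock–Kurzweil integrable function. -/
def hkPrimitive (f : ℝ → ℝ) (x : ℝ) : ℝ := hkIntegral f 0 x - hkIntegral f x 0

theorem hkPrimitive_sub {f : ℝ → ℝ} (hf : ∀ a b : ℝ, a < b → HKIntegrable f a b) {a b : ℝ}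
    (hab : a < b) : hkPrimitive f b - hkPrimitive f a = hkIntegral f a b := by
  unfold hkPrimitive
  rcases lt_trichotomy a 0 with ha | rfl | ha
  · rw [hkIntegral_of_not_lt f ha.not_gt]
    rcases lt_trichotomy b 0 with hb | rfl | hb
    · rw [hkIntegral_of_not_lt f hb.not_gt, ← hkIntegral_add hab hb (hf a 0 ha)]
      ring
    · rw [hkIntegral_of_not_lt f (lt_irrefl 0)]; ring
    · rw [hkIntegral_of_not_lt f hb.not_gt, ← hkIntegral_add ha hb (hf a b hab)]
      ring
  · rw [hkIntegral_of_not_lt f (lt_irrefl 0), hkIntegral_of_not_lt f hab.not_gt]; ring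
  · rw [hkIntegral_of_not_lt f ha.not_gt, hkIntegral_of_not_lt f (ha.trans hab).not_gt,
      ← hkIntegral_add ha hab (hf 0 b (ha.trans hab))]
    ring

theorem henstock_memBaseSet {I : BoxIntegral.Box (Fin 1)} {c : NNReal}
    {r : (Fin 1 → ℝ) → Ioi (0 : ℝ)} {π : BoxIntegral.TaggedPrepartition I}
    (h1 : π.IsSubordinate r) (h2 : π.IsHenstock) :
    BoxIntegral.IntegrationParams.Henstock.MemBaseSet I c r π :=
  ⟨h1, fun _ => h2, fun h => absurd h (by simp [BoxIntegral.IntegrationParams.Henstock]),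
    fun h => absurd h (by simp [BoxIntegral.IntegrationParams.Henstock])⟩

/-- The Saks–Henstock lemma. -/
theorem exists_gauge_sum_abs_le {f : ℝ → ℝ} (hf : ∀ a b : ℝ, a < b → HKIntegrable f a b)
    {a b : ℝ} (hab : a < b) {ε : ℝ} (hε : 0 < ε) :
    ∃ r : (Fin 1 → ℝ) → Ioi (0 : ℝ), ∀ π : BoxIntegral.TaggedPrepartition (ivl a b hab),
      π.IsSubordinate r → π.IsHenstock →
      ∑ J ∈ π.boxes, |f (π.tag J 0) * (J.upper 0 - J.lower 0) -
        (hkPrimitive f (J.upper 0) - hkPrimitive f (J.lower 0))| ≤ ε := by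
  obtain ⟨_, hi⟩ := hf a b hab
  refine ⟨hi.convergenceR (ε / 2) 0, fun π h1 h2 => ?_⟩
  set t : BoxIntegral.Box (Fin 1) → ℝ := fun J => f (π.tag J 0) * (J.upper 0 - J.lower 0) -
        (hkPrimitive f (J.upper 0) - hkPrimitive f (J.lower 0)) with ht
  -- The Henstock inequality holds for every subfamily of the partition; applying it to the
  -- nonnegative and to the negative terms bounds the sum of absolute values.
  have key : ∀ p : BoxIntegral.Box (Fin 1) → Prop,
      |∑ J ∈ (π.filter p).boxes, t J| ≤ ε / 2 := by
    intro p
    have h3 := hi.dist_integralSum_sum_integral_le_of_memBaseSet (half_pos hε)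
      ((henstock_memBaseSet (c := 0) h1 h2).filter p)
    rw [Real.dist_eq, BoxIntegral.integralSum, ← Finset.sum_sub_distrib] at h3
    convert h3 using 3 with J hJ
    rw [← hkIntegral_lower_upper f J, ← hkPrimitive_sub hf (J.lower_lt_upper 0),
      BoxIntegral.BoxAdditiveMap.volume_apply]
    simp only [ht, Finset.univ_unique, Fin.default_eq_zero, Fin.isValue, Finset.prod_singleton,
      smul_eq_mul]
    rw [mul_comm (f _)]
    rfl
  classical
  have hb : ∀ (p : BoxIntegral.Box (Fin 1) → Prop) [DecidablePred p],
      (π.filter p).boxes = π.boxes.filter p := fun p _ => by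
    ext J
    rw [Finset.mem_filter]
    exact π.mem_filter
  rw [← Finset.sum_filter_add_sum_filter_not π.boxes (fun J => 0 ≤ t J)]
  have e1 := key (fun J => 0 ≤ t J)
  have e2 := key (fun J => ¬0 ≤ t J)
  rw [hb] at e1 e2
  have e3 : ∑ J ∈ π.boxes.filter (fun J => 0 ≤ t J), |t J| =
      ∑ J ∈ π.boxes.filter (fun J => 0 ≤ t J), t J :=
    Finset.sum_congr rfl fun J hJ => abs_of_nonneg (Finset.mem_filter.1 hJ).2
  have e4 : ∑ J ∈ π.boxes.filter (fun J => ¬0 ≤ t J), |t J| =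
      -∑ J ∈ π.boxes.filter (fun J => ¬0 ≤ t J), t J := by
    rw [← Finset.sum_neg_distrib]
    exact Finset.sum_congr rfl fun J hJ => abs_of_neg (not_le.1 (Finset.mem_filter.1 hJ).2)
  rw [e3, e4]
  linarith [(abs_le.1 e1).2, (abs_le.1 e2).1]

theorem Icc_ivl_subset_closedBall {l u x : ℝ} (h : l < u) {r : ℝ} (hl : x - r ≤ l)
    (hu : u ≤ x + r) :
    BoxIntegral.Box.Icc (ivl l u h) ⊆ Metric.closedBall (fun _ : Fin 1 => x) r := by
  intro y hy
  have hr : 0 ≤ r := by linarith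
  rw [Metric.mem_closedBall, dist_pi_le_iff hr]
  intro i
  have h1 : l ≤ y i := hy.1 i
  have h2 : y i ≤ u := hy.2 i
  rw [Real.dist_eq, abs_le]
  constructor <;> linarith

theorem ivl_le_ivl {a b l u : ℝ} (hab : a < b) (hlu : l < u) (h1 : a ≤ l) (h2 : u ≤ b) :
    ivl l u hlu ≤ ivl a b hab :=
  BoxIntegral.Box.le_iff_bounds.2 ⟨fun _ => h1, fun _ => h2⟩

/-- Saks–Henstock for a single interval tagged at its endpoint `x` says that the increment of the
primitive is close to `f x * (y - x)`, which is small. -/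
theorem continuous_hkPrimitive {f : ℝ → ℝ} (hf : ∀ a b : ℝ, a < b → HKIntegrable f a b) :
    Continuous (hkPrimitive f) := by
  rw [continuous_iff_continuousAt]
  intro x
  rw [Metric.continuousAt_iff]
  intro ε hε
  have hab : x - 1 < x + 1 := by linarith
  obtain ⟨r, hr⟩ := exists_gauge_sum_abs_le hf hab (half_pos hε)
  have hxI : (fun _ : Fin 1 => x) ∈ BoxIntegral.Box.Icc (ivl (x - 1) (x + 1) hab) :=
    ⟨fun _ => by simp [ivl], fun _ => by simp [ivl]⟩
  set ρ := (r fun _ => x : ℝ) with hρ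
  have hρ0 : 0 < ρ := (r fun _ => x).2
  have key : ∀ l u : ℝ, ∀ h : l < u, x - 1 ≤ l → u ≤ x + 1 → l ≤ x → x ≤ u → x - ρ ≤ l →
      u ≤ x + ρ → |f x * (u - l) - (hkPrimitive f u - hkPrimitive f l)| ≤ ε / 2 := by
    intro l u h h1 h2 h3 h4 h5 h6
    have := hr (BoxIntegral.TaggedPrepartition.single _ (ivl l u h) (ivl_le_ivl hab h h1 h2)
      (fun _ => x) hxI)
      ((BoxIntegral.TaggedPrepartition.isSubordinate_single _ hxI).2
        (Icc_ivl_subset_closedBall h h5 h6))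
      ((BoxIntegral.TaggedPrepartition.isHenstock_single_iff _ hxI).2
        ⟨fun _ => h3, fun _ => h4⟩)
    simpa [BoxIntegral.TaggedPrepartition.single, BoxIntegral.Prepartition.single, ivl] using this
  refine ⟨min 1 (min ρ (ε / (2 * (|f x| + 1)))), by positivity, fun {y} hy => ?_⟩
  rw [Real.dist_eq] at hy ⊢
  have hy1 := hy.trans_le (min_le_left _ _)
  have hy2 := hy.trans_le ((min_le_right _ _).trans (min_le_left _ _))
  have hy3 := hy.trans_le ((min_le_right _ _).trans (min_le_right _ _))
  rw [lt_div_iff₀ (by positivity)] at hy3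
  have hfy : |f x * (y - x)| < ε / 2 := by
    rw [abs_mul]; nlinarith [abs_nonneg (y - x), abs_nonneg (f x)]
  rw [abs_lt] at hy1 hy2 hfy
  rcases lt_trichotomy x y with h | h | h
  · have := abs_le.1 (key x y h (by linarith) (by linarith) le_rfl h.le (by linarith) (by linarith))
    rw [abs_lt]; constructor <;> linarith
  · simp [h, hε]
  · have := abs_le.1 (key y x h (by linarith) (by linarith) h.le le_rfl (by linarith) (by linarith))
    rw [abs_lt]; constructor <;> linarith

/-- A Henstock–Kurzweil primitive becomes a major function after adding a small increasing
function. -/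
theorem exists_monotone_majorant {f : ℝ → ℝ} (hf : ∀ a b : ℝ, a < b → HKIntegrable f a b)
    {a b : ℝ} (hab : a < b) {ε : ℝ} (hε : 0 < ε) :
    ∃ E : ℝ → ℝ, Monotone E ∧ (∀ x, 0 ≤ E x) ∧ (∀ x, E x ≤ ε) ∧ ∀ θ ∈ Ioo a b, ∃ δ > 0, ∀ l u,
      l < u → θ - δ ≤ l → l ≤ θ → θ ≤ u → u ≤ θ + δ →
        f θ * (u - l) - (hkPrimitive f u - hkPrimitive f l) ≤ E u - E l := by
  classical
  obtain ⟨r, hr⟩ := exists_gauge_sum_abs_le hf hab hε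
  set T : BoxIntegral.TaggedPrepartition (ivl a b hab) → BoxIntegral.Box (Fin 1) → ℝ :=
    fun π J => f (π.tag J 0) * (J.upper 0 - J.lower 0) -
        (hkPrimitive f (J.upper 0) - hkPrimitive f (J.lower 0)) with hT
  -- `E x` is the supremum of the signed Saks–Henstock errors over fine partial partitions to the
  -- left of `x`. Appending one interval `[l, u]` tagged at `θ` to a family left of `l` gives a
  -- family left of `u`, which is the required increment inequality.
  set S : ℝ → Set ℝ := fun x => {s | ∃ π : BoxIntegral.TaggedPrepartition (ivl a b hab),
    π.IsSubordinate r ∧ π.IsHenstock ∧ (∀ J ∈ π.boxes, J.upper 0 ≤ x) ∧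
      ∑ J ∈ π.boxes, T π J = s} with hS
  have hSε : ∀ x, ∀ s ∈ S x, s ≤ ε := by
    rintro x s ⟨π, h1, h2, -, rfl⟩
    exact (Finset.sum_le_sum fun J _ => le_abs_self (T π J)).trans (hr π h1 h2)
  have hSb : ∀ x, BddAbove (S x) := fun x => ⟨ε, fun s hs => hSε x s hs⟩
  have hS0 : ∀ x, (0 : ℝ) ∈ S x := by
    intro x
    -- Filtering out every box gives the empty partial partition, with sum `0`.
    set I := ivl a b hab
    set π := (BoxIntegral.TaggedPrepartition.single I I le_rfl I.upper I.upper_mem_Icc).filter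
      (fun _ => False) with hπ
    have h0 : ∀ J, J ∉ π := fun J hJ => ((BoxIntegral.TaggedPrepartition.mem_filter _).1 hJ).2
    have h1 : π.boxes = ∅ := Finset.eq_empty_of_forall_notMem h0
    exact ⟨π, fun J hJ => (h0 J hJ).elim, fun J hJ => (h0 J hJ).elim,
      fun J hJ => (h0 J hJ).elim, by rw [h1, Finset.sum_empty]⟩
  refine ⟨fun x => sSup (S x), fun x y hxy => ?_, fun x => le_csSup (hSb x) (hS0 x),
    fun x => csSup_le ⟨0, hS0 x⟩ (hSε x), fun θ hθ => ?_⟩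
  · refine csSup_le_csSup (hSb y) ⟨0, hS0 x⟩ ?_
    rintro s ⟨π, h1, h2, h3, h4⟩
    exact ⟨π, h1, h2, fun J hJ => (h3 J hJ).trans hxy, h4⟩
  · set ρ := (r fun _ => θ : ℝ) with hρ
    have hρ0 : 0 < ρ := (r fun _ => θ).2
    refine ⟨min ρ (min (θ - a) (b - θ)),
      lt_min hρ0 (lt_min (by linarith [hθ.1]) (by linarith [hθ.2])), fun l u hlt hl hlθ hθu hu => ?_⟩
    have ht1 : min ρ (min (θ - a) (b - θ)) ≤ ρ := min_le_left _ _
    have ht2 : min ρ (min (θ - a) (b - θ)) ≤ θ - a := (min_le_right _ _).trans (min_le_left _ _)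
    have ht3 : min ρ (min (θ - a) (b - θ)) ≤ b - θ := (min_le_right _ _).trans (min_le_right _ _)
    have hle := ivl_le_ivl hab hlt (by linarith) (by linarith)
    have hθI : (fun _ : Fin 1 => θ) ∈ BoxIntegral.Box.Icc (ivl a b hab) :=
      ⟨fun _ => hθ.1.le, fun _ => hθ.2.le⟩
    set σ := BoxIntegral.TaggedPrepartition.single (ivl a b hab) (ivl l u hlt) hle
      (fun _ => θ) hθI with hσ
    rw [le_sub_iff_add_le, ← le_sub_iff_add_le']
    refine csSup_le ⟨0, hS0 _⟩ ?_
    rintro s ⟨π, h1, h2, h3, rfl⟩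
    rw [le_sub_iff_add_le]
    refine le_csSup (hSb _) ?_
    have hdisj : Disjoint π.iUnion σ.iUnion := by
      rw [Set.disjoint_left]
      intro y hy hy'
      obtain ⟨J, hJ, hyJ⟩ := π.mem_iUnion.1 hy
      rw [hσ, BoxIntegral.TaggedPrepartition.iUnion_single] at hy'
      have e1 : y 0 ≤ J.upper 0 := (hyJ 0).2
      have e2 : l < y 0 := (hy' 0).1
      linarith [h3 J hJ]
    have hne : ∀ J ∈ π.boxes, J ∉ σ.boxes := by
      intro J hJ hJ'
      have e1 : J = ivl l u hlt := Finset.mem_singleton.1 hJ'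
      have e2 := h3 J hJ
      rw [e1] at e2
      change u ≤ l at e2
      linarith
    refine ⟨π.disjUnion σ hdisj, h1.disjUnion ?_ hdisj, h2.disjUnion ?_ hdisj, ?_, ?_⟩
    · exact (BoxIntegral.TaggedPrepartition.isSubordinate_single _ hθI).2
        (Icc_ivl_subset_closedBall hlt (by linarith) (by linarith))
    · exact (BoxIntegral.TaggedPrepartition.isHenstock_single_iff _ hθI).2
        ⟨fun _ => hlθ, fun _ => hθu⟩
    · intro J hJ
      rcases (BoxIntegral.TaggedPrepartition.mem_disjUnion hdisj).1 hJ with h | h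
      · linarith [h3 J h]
      · have e1 : J = ivl l u hlt := Finset.mem_singleton.1 h
        rw [e1]; exact le_rfl
    · rw [BoxIntegral.TaggedPrepartition.disjUnion_boxes,
        Finset.sum_union (Finset.disjoint_left.2 hne)]
      have e1 : ∑ J ∈ π.boxes, T (π.disjUnion σ hdisj) J = ∑ J ∈ π.boxes, T π J := by
        refine Finset.sum_congr rfl fun J hJ => ?_
        simp only [hT]
        rw [BoxIntegral.TaggedPrepartition.disjUnion_tag_of_mem_left hdisj hJ]
      have e2 : ∑ J ∈ σ.boxes, T (π.disjUnion σ hdisj) J =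
          f θ * (u - l) - (hkPrimitive f u - hkPrimitive f l) := by
        have e3 : σ.boxes = {ivl l u hlt} := rfl
        rw [e3, Finset.sum_singleton]
        simp only [hT]
        rw [BoxIntegral.TaggedPrepartition.disjUnion_tag_of_mem_right hdisj
          (show ivl l u hlt ∈ σ from Finset.mem_singleton_self _)]
        rfl
      rw [e1, e2, add_comm]

/-- Integration by parts for the Henstock–Kurzweil integral. -/
theorem hasIntegral_mul {f : ℝ → ℝ} (hf : ∀ a b : ℝ, a < b → HKIntegrable f a b)
    {g g' : ℝ → ℝ} (hg : ∀ x, HasDerivAt g (g' x) x) (hg' : Continuous g')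
    {a b : ℝ} (hab : a < b) :
    BoxIntegral.HasIntegral (ivl a b hab) BoxIntegral.IntegrationParams.Henstock
      (fun x : Fin 1 → ℝ => f (x 0) * g (x 0)) BoxIntegral.BoxAdditiveMap.volume
      (hkPrimitive f b * g b - hkPrimitive f a * g a - ∫ x in a..b, hkPrimitive f x * g' x) := by
  set F := hkPrimitive f with hF
  have hFc : Continuous F := continuous_hkPrimitive hf
  have hgc : Continuous g := continuous_iff_continuousAt.2 fun x => (hg x).continuousAt
  -- The claimed value is an increment of `ψ`, so it splits over any partition and can be compared
  -- with the Riemann sum box by box.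
  set ψ : ℝ → ℝ := fun x => F x * g x - ∫ y in a..x, F y * g' y with hψ
  have hval : F b * g b - F a * g a - ∫ x in a..b, F x * g' x = ψ b - ψ a := by
    simp only [hψ, intervalIntegral.integral_same]; ring
  rw [hval]
  obtain ⟨G, hG⟩ := (isCompact_Icc (a := a) (b := b)).exists_bound_of_continuousOn hgc.continuousOn
  obtain ⟨L, hL⟩ := (isCompact_Icc (a := a) (b := b)).exists_bound_of_continuousOn hg'.continuousOn
  have hG0 : 0 ≤ G := (norm_nonneg _).trans (hG a ⟨le_rfl, hab.le⟩)
  have hL0 : 0 ≤ L := (norm_nonneg _).trans (hL a ⟨le_rfl, hab.le⟩)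
  refine BoxIntegral.HasIntegral.of_mul (G + L * (b - a)) fun ε hε => ?_
  obtain ⟨r, hr⟩ := exists_gauge_sum_abs_le hf hab hε
  obtain ⟨δ, hδ, hosc⟩ := Metric.uniformContinuousOn_iff.1
    (isCompact_Icc.uniformContinuousOn_of_continuous (hFc.continuousOn (s := Icc a b))) ε hε
  refine ⟨fun _ x => ⟨min (r x : ℝ) (δ / 3), lt_min (show (0 : ℝ) < r x from (r x).2) (show 0 < δ / 3 by positivity)⟩,
    fun _ => BoxIntegral.IntegrationParams.rCond_of_bRiemann_eq_false _ rfl, fun c π hπ hπp => ?_⟩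
  have hsub := hπ.isSubordinate
  have hhen : π.IsHenstock := hπ.isHenstock rfl
  have hsum := hr π (hsub.mono' fun J _ => Subtype.coe_le_coe.1 (min_le_left _ _)) hhen
  rw [BoxIntegral.integralSum, ← sum_increment ψ hπp, Real.dist_eq, ← Finset.sum_sub_distrib]
  have hterm : ∀ J ∈ π.boxes,
      |BoxIntegral.BoxAdditiveMap.volume J (f (π.tag J 0) * g (π.tag J 0)) -
        (ψ (J.upper 0) - ψ (J.lower 0))| ≤
      G * |f (π.tag J 0) * (J.upper 0 - J.lower 0) - (F (J.upper 0) - F (J.lower 0))| +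
        L * ε * (J.upper 0 - J.lower 0) := by
    intro J hJ
    set l := J.lower 0 with hl
    set u := J.upper 0 with hu
    set ξ := π.tag J 0 with hξ
    have hJI := π.le_of_mem' J hJ
    have hal : a ≤ l := (BoxIntegral.Box.le_iff_bounds.1 hJI).1 0
    have hub : u ≤ b := (BoxIntegral.Box.le_iff_bounds.1 hJI).2 0
    have hlξ : l ≤ ξ := (hhen J hJ).1 0
    have hξu : ξ ≤ u := (hhen J hJ).2 0
    have hlen : u - l < δ := by
      have h1 := hsub J hJ J.upper_mem_Icc
      have h2 := hsub J hJ J.lower_mem_Icc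
      have h3 := (dist_le_pi_dist J.upper (π.tag J) 0).trans (Metric.mem_closedBall.1 h1)
      have h4 := (dist_le_pi_dist J.lower (π.tag J) 0).trans (Metric.mem_closedBall.1 h2)
      have h3' := h3.trans (min_le_right _ _)
      have h4' := h4.trans (min_le_right _ _)
      rw [Real.dist_eq, abs_le] at h3' h4'
      linarith [h3'.2, h4'.1]
    have hFosc : ∀ x ∈ Icc l u, ∀ y ∈ Icc l u, |F x - F y| ≤ ε := by
      intro x hx y hy
      refine (hosc x ⟨by linarith [hx.1], by linarith [hx.2]⟩ y
        ⟨by linarith [hy.1], by linarith [hy.2]⟩ ?_).le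
      rw [Real.dist_eq, abs_lt]
      constructor <;> linarith [hx.1, hx.2, hy.1, hy.2]
    have hint : ∀ p q : ℝ, IntervalIntegrable (fun y => F y * g' y) MeasureTheory.volume p q :=
      fun p q => (hFc.mul hg').intervalIntegrable p q
    have hfund : ∀ p q : ℝ, ∫ y in p..q, g' y = g q - g p := fun p q =>
      intervalIntegral.integral_eq_sub_of_hasDerivAt (fun x _ => hg x) (hg'.intervalIntegrable p q)
    have hsmall : ∀ C p q : ℝ, p ≤ q → l ≤ p → q ≤ u → C ∈ Icc l u →
        |F C * (g q - g p) - ∫ y in p..q, F y * g' y| ≤ L * ε * (q - p) := by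
      intro C p q hpq hlp hqu hC
      rw [← hfund, ← intervalIntegral.integral_const_mul, ← intervalIntegral.integral_sub
        ((hg'.intervalIntegrable p q).const_mul _) (hint p q)]
      have := intervalIntegral.norm_integral_le_of_norm_le_const (a := p) (b := q) (C := L * ε)
        (f := fun y => F C * g' y - F y * g' y) (fun y hy => by
          rw [uIoc_of_le hpq] at hy
          rw [← sub_mul, norm_mul, mul_comm]
          exact mul_le_mul (hL y ⟨by linarith [hy.1], by linarith [hy.2]⟩)
            (hFosc C hC y ⟨by linarith [hy.1], by linarith [hy.2]⟩) (norm_nonneg _) hL0)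
      rwa [abs_of_nonneg (sub_nonneg.2 hpq)] at this
    have e1 := hsmall u ξ u hξu hlξ le_rfl ⟨by linarith, le_rfl⟩
    have e2 := hsmall l l ξ hlξ le_rfl hξu ⟨le_rfl, by linarith⟩
    have e3 : (∫ y in a..u, F y * g' y) =
        (∫ y in a..l, F y * g' y) + (∫ y in l..ξ, F y * g' y) + ∫ y in ξ..u, F y * g' y := by
      rw [intervalIntegral.integral_add_adjacent_intervals (hint _ _) (hint _ _),
        intervalIntegral.integral_add_adjacent_intervals (hint _ _) (hint _ _)]
    have e4 : BoxIntegral.BoxAdditiveMap.volume J (f ξ * g ξ) = (u - l) * (f ξ * g ξ) := by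
      rw [BoxIntegral.BoxAdditiveMap.volume_apply]
      simp [hu, hl]
    have e5 : |g ξ * (f ξ * (u - l) - (F u - F l))| ≤ G * |f ξ * (u - l) - (F u - F l)| := by
      rw [abs_mul]
      exact mul_le_mul_of_nonneg_right (hG ξ ⟨by linarith, by linarith⟩) (abs_nonneg _)
    -- Splitting at the tag leaves `g ξ` times a Saks–Henstock error, plus two terms controlled by
    -- the oscillation of `F` on the box.
    have e6 : BoxIntegral.BoxAdditiveMap.volume J (f ξ * g ξ) - (ψ u - ψ l) =
        g ξ * (f ξ * (u - l) - (F u - F l)) -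
          (F u * (g u - g ξ) - ∫ y in ξ..u, F y * g' y) -
          (F l * (g ξ - g l) - ∫ y in l..ξ, F y * g' y) := by
      rw [e4]
      simp only [hψ]
      rw [e3]
      ring
    rw [e6]
    refine (abs_sub _ _).trans ?_
    refine (add_le_add (abs_sub _ _) le_rfl).trans ?_
    linarith
  refine (Finset.abs_sum_le_sum_abs _ _).trans ((Finset.sum_le_sum hterm).trans ?_)
  rw [Finset.sum_add_distrib, ← Finset.mul_sum, ← Finset.mul_sum,
    sum_increment (fun x => x) hπp]
  have := mul_le_mul_of_nonneg_left hsum hG0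
  linarith

/-! ### Estimates for Poisson–Stieltjes integrals -/

/-- On `n + 1` equal pieces the allowed losses telescope to `K * (q - p) * (E q - E p) / (n + 1)`,
which tends to `0`. -/
theorem le_of_increment_ge {ψ E : ℝ → ℝ} {p q K : ℝ} (hpq : p ≤ q)
    (h : ∀ x y, p ≤ x → x ≤ y → y ≤ q → -(K * (y - x) * (E y - E x)) ≤ ψ y - ψ x) :
    ψ p ≤ ψ q := by
  have key : ∀ n : ℕ, -(K * (q - p) * (E q - E p)) / (n + 1 : ℝ) ≤ ψ q - ψ p := by
    intro n
    have hn : (0 : ℝ) < n + 1 := by positivity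
    set x : ℕ → ℝ := fun i => p + i * ((q - p) / (n + 1)) with hx
    have hd : 0 ≤ (q - p) / (n + 1) := div_nonneg (sub_nonneg.2 hpq) hn.le
    have h0 : x 0 = p := by simp [hx]
    have h1 : x (n + 1) = q := by
      simp only [hx]; push_cast; field_simp; ring
    have hstep : ∀ i, x (i + 1) - x i = (q - p) / (n + 1) := by
      intro i; simp only [hx]; push_cast; ring
    have hle : ∀ i, i ≤ n + 1 → x i ≤ q := by
      intro i hi
      rw [← h1]
      simp only [hx]
      have : (i : ℝ) ≤ ((n + 1 : ℕ) : ℝ) := by exact_mod_cast hi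
      have := mul_le_mul_of_nonneg_right this hd
      linarith
    have hge : ∀ i, p ≤ x i := by
      intro i
      simp only [hx]
      have : (0 : ℝ) ≤ i * ((q - p) / (n + 1)) := by positivity
      linarith
    have hsum : ∑ i ∈ Finset.range (n + 1), -(K * ((q - p) / (n + 1)) * (E (x (i + 1)) - E (x i)))
        ≤ ∑ i ∈ Finset.range (n + 1), (ψ (x (i + 1)) - ψ (x i)) := by
      refine Finset.sum_le_sum fun i hi => ?_
      have := h (x i) (x (i + 1)) (hge i) (by linarith [hstep i])
        (hle _ (Finset.mem_range.1 hi))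
      rwa [hstep] at this
    rw [Finset.sum_range_sub (fun i => ψ (x i)), Finset.sum_neg_distrib, ← Finset.mul_sum,
      Finset.sum_range_sub (fun i => E (x i)), h0, h1] at hsum
    calc -(K * (q - p) * (E q - E p)) / (n + 1 : ℝ)
        = -(K * ((q - p) / (n + 1)) * (E q - E p)) := by field_simp
      _ ≤ _ := hsum
  have hlim : Tendsto (fun n : ℕ => -(K * (q - p) * (E q - E p)) / (n + 1 : ℝ)) atTop (𝓝 0) := by
    have := (tendsto_one_div_add_atTop_nhds_zero_nat (𝕜 := ℝ)).const_mul
      (-(K * (q - p) * (E q - E p)))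
    rw [mul_zero] at this
    refine this.congr fun n => ?_
    rw [mul_one_div]
  linarith [le_of_tendsto' hlim key]

/-- The Stieltjes integral of a nonnegative function against an increasing function is
nonnegative. -/
theorem stieltjes_nonneg {E g g' : ℝ → ℝ} (hE : Monotone E) (hg : ∀ x, HasDerivAt g (g' x) x)
    (hg' : Continuous g') (hg0 : ∀ x, 0 ≤ g x) {p q : ℝ} (hpq : p ≤ q) :
    0 ≤ E q * g q - E p * g p - ∫ x in p..q, E x * g' x := by
  obtain ⟨L, hL⟩ := (isCompact_Icc (a := p) (b := q)).exists_bound_of_continuousOn hg'.continuousOn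
  have hL0 : 0 ≤ L := (norm_nonneg _).trans (hL p ⟨le_rfl, hpq⟩)
  have hint : ∀ x y : ℝ, IntervalIntegrable (fun t => E t * g' t) MeasureTheory.volume x y :=
    fun x y => hE.intervalIntegrable.mul_continuousOn hg'.continuousOn
  have := le_of_increment_ge (ψ := fun x => E x * g x - ∫ t in p..x, E t * g' t) (E := E) (K := L)
    hpq (fun x y hx hxy hy => by
      have h1 : (∫ t in p..y, E t * g' t) - ∫ t in p..x, E t * g' t = ∫ t in x..y, E t * g' t :=
        intervalIntegral.integral_interval_sub_left (hint _ _) (hint _ _)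
      have h2 : ∫ t in x..y, g' t = g y - g x :=
        intervalIntegral.integral_eq_sub_of_hasDerivAt (fun t _ => hg t)
          (hg'.intervalIntegrable x y)
      have h3 : |∫ t in x..y, (E y * g' t - E t * g' t)| ≤ (L * (E y - E x)) * |y - x| := by
        refine intervalIntegral.norm_integral_le_of_norm_le_const
          (f := fun t => E y * g' t - E t * g' t) fun t ht => ?_
        rw [uIoc_of_le hxy] at ht
        rw [← sub_mul, norm_mul, mul_comm]
        refine mul_le_mul (hL t ⟨by linarith [ht.1], by linarith [ht.2]⟩) ?_ (norm_nonneg _) hL0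
        rw [Real.norm_of_nonneg (sub_nonneg.2 (hE ht.2))]
        linarith [hE ht.1.le]
      rw [intervalIntegral.integral_sub ((hg'.intervalIntegrable x y).const_mul _) (hint x y),
        intervalIntegral.integral_const_mul, h2, abs_of_nonneg (sub_nonneg.2 hxy)] at h3
      -- The increment of `ψ` is this nonnegative term plus an error bounded in `h3` by the product
      -- of the increments of `E` and of the variable.
      have h4 : 0 ≤ (E y - E x) * g x := mul_nonneg (sub_nonneg.2 (hE hxy)) (hg0 x)
      have h5 := (abs_le.1 h3).1
      linarith)
  simp only [intervalIntegral.integral_same] at this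
  linarith

section

variable {r : ℝ}

theorem intervalIntegrable_mul_poissonKerDeriv (hr0 : 0 ≤ r) (hr1 : r < 1) {N : ℝ → ℝ}
    {α β : ℝ} (hN : IntervalIntegrable N MeasureTheory.volume α β) (θ : ℝ) :
    IntervalIntegrable (fun φ => N φ * poissonKerDeriv r (φ - θ)) MeasureTheory.volume α β :=
  hN.mul_continuousOn ((continuous_poissonKerDeriv hr0 hr1).comp (by fun_prop)).continuousOn

theorem poissonStieltjes_add_adjacent (hr0 : 0 ≤ r) (hr1 : r < 1) {N : ℝ → ℝ}
    (hN : ∀ a b, IntervalIntegrable N MeasureTheory.volume a b) (α β γ θ : ℝ) :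
    poissonStieltjes N α β r θ + poissonStieltjes N β γ r θ = poissonStieltjes N α γ r θ := by
  unfold poissonStieltjes
  rw [← intervalIntegral.integral_add_adjacent_intervals
    (intervalIntegrable_mul_poissonKerDeriv hr0 hr1 (hN α β) θ)
    (intervalIntegrable_mul_poissonKerDeriv hr0 hr1 (hN β γ) θ)]
  ring

theorem poissonStieltjes_add (hr0 : 0 ≤ r) (hr1 : r < 1) {N M : ℝ → ℝ} {α β : ℝ}
    (hN : IntervalIntegrable N MeasureTheory.volume α β)
    (hM : IntervalIntegrable M MeasureTheory.volume α β) (θ : ℝ) :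
    poissonStieltjes (fun x => N x + M x) α β r θ =
      poissonStieltjes N α β r θ + poissonStieltjes M α β r θ := by
  unfold poissonStieltjes
  simp only [add_mul]
  rw [intervalIntegral.integral_add (intervalIntegrable_mul_poissonKerDeriv hr0 hr1 hN θ)
    (intervalIntegrable_mul_poissonKerDeriv hr0 hr1 hM θ)]
  ring

theorem hasDerivAt_poissonKer_sub (hr0 : 0 ≤ r) (hr1 : r < 1) (θ φ : ℝ) :
    HasDerivAt (fun φ => poissonKer r (φ - θ)) (poissonKerDeriv r (φ - θ)) φ :=
  (hasDerivAt_poissonKer hr0 hr1 (φ - θ)).comp_sub_const φ θ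

theorem continuous_poissonKerDeriv_sub (hr0 : 0 ≤ r) (hr1 : r < 1) (θ : ℝ) :
    Continuous fun φ => poissonKerDeriv r (φ - θ) :=
  (continuous_poissonKerDeriv hr0 hr1).comp (by fun_prop)

theorem continuous_poissonKer_sub (hr0 : 0 ≤ r) (hr1 : r < 1) (θ : ℝ) :
    Continuous fun φ => poissonKer r (φ - θ) :=
  (continuous_poissonKer hr0 hr1).comp (by fun_prop)

theorem poissonStieltjes_of_hasDerivAt (hr0 : 0 ≤ r) (hr1 : r < 1) {N N' : ℝ → ℝ}
    (hN : ∀ x, HasDerivAt N (N' x) x) (hN' : Continuous N') (α β θ : ℝ) :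
    poissonStieltjes N α β r θ = ∫ φ in α..β, N' φ * poissonKer r (φ - θ) := by
  unfold poissonStieltjes
  rw [intervalIntegral.integral_mul_deriv_eq_deriv_mul (fun x _ => hN x)
    (fun x _ => hasDerivAt_poissonKer_sub hr0 hr1 θ x) (hN'.intervalIntegrable _ _)
    ((continuous_poissonKerDeriv_sub hr0 hr1 θ).intervalIntegrable _ _)]
  ring

theorem integral_poissonKer_sub (hr0 : 0 ≤ r) (hr1 : r < 1) (a θ : ℝ) :
    ∫ φ in a..(a + 2 * Real.pi), poissonKer r (φ - θ) = 1 := by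
  rw [intervalIntegral.integral_comp_sub_right (poissonKer r),
    show a + 2 * Real.pi - θ = (a - θ) + 2 * Real.pi by ring, integral_poissonKer hr0 hr1]

theorem poissonStieltjes_nonneg (hr0 : 0 ≤ r) (hr1 : r < 1) {E : ℝ → ℝ} (hE : Monotone E)
    {α β : ℝ} (hαβ : α ≤ β) (θ : ℝ) : 0 ≤ poissonStieltjes E α β r θ :=
  stieltjes_nonneg hE (hasDerivAt_poissonKer_sub hr0 hr1 θ)
    (continuous_poissonKerDeriv_sub hr0 hr1 θ) (fun _ => (poissonKer_pos hr0 hr1 _).le) hαβ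

/-- Positivity of the Stieltjes integral, applied to `1 / (1 - r)` minus the Poisson kernel. -/
theorem poissonStieltjes_le (hr0 : 0 ≤ r) (hr1 : r < 1) {E : ℝ → ℝ} (hE : Monotone E)
    {α β : ℝ} (hαβ : α ≤ β) (θ : ℝ) :
    poissonStieltjes E α β r θ ≤ (E β - E α) / (1 - r) := by
  have h := stieltjes_nonneg hE (g := fun φ => 1 / (1 - r) - poissonKer r (φ - θ))
    (fun x => (hasDerivAt_poissonKer_sub hr0 hr1 θ x).const_sub _)
    (continuous_poissonKerDeriv_sub hr0 hr1 θ).neg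
    (fun _ => sub_nonneg.2 (poissonKer_le hr0 hr1 _)) hαβ
  simp only [mul_neg, intervalIntegral.integral_neg] at h
  unfold poissonStieltjes
  rw [div_eq_mul_one_div]
  linarith

theorem abs_poissonStieltjes_le (hr0 : 0 ≤ r) (hr1 : r < 1) {N : ℝ → ℝ} {α B : ℝ}
    (hB : ∀ x ∈ Icc α (α + 2 * Real.pi), |N x| ≤ B) (θ : ℝ) :
    |poissonStieltjes N α (α + 2 * Real.pi) r θ| ≤ 3 * B / (1 - r) := by
  have h0 : 0 < 1 - r := by linarith
  have hle : α ≤ α + 2 * Real.pi := by linarith [Real.pi_pos]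
  have hB0 : 0 ≤ B := (abs_nonneg _).trans (hB α ⟨le_rfl, hle⟩)
  have h1 : ∀ x ∈ Icc α (α + 2 * Real.pi), |N x * poissonKer r (x - θ)| ≤ B * (1 / (1 - r)) := by
    intro x hx
    rw [abs_mul, abs_of_pos (poissonKer_pos hr0 hr1 _)]
    exact mul_le_mul (hB x hx) (poissonKer_le hr0 hr1 _) (poissonKer_pos hr0 hr1 _).le hB0
  have h2 : |∫ φ in α..(α + 2 * Real.pi), N φ * poissonKerDeriv r (φ - θ)| ≤
      ∫ φ in α..(α + 2 * Real.pi), B / (1 - r) * poissonKer r (φ - θ) := by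
    refine intervalIntegral.norm_integral_le_of_norm_le
      (f := fun φ => N φ * poissonKerDeriv r (φ - θ)) hle (Eventually.of_forall fun x hx => ?_)
      (((continuous_poissonKer_sub hr0 hr1 θ).intervalIntegrable _ _).const_mul _)
    rw [norm_mul]
    calc |N x| * |poissonKerDeriv r (x - θ)| ≤ B * (poissonKer r (x - θ) / (1 - r)) :=
          mul_le_mul (hB x (Ioc_subset_Icc_self hx)) (abs_poissonKerDeriv_le hr0 hr1 _)
            (abs_nonneg _) hB0
      _ = B / (1 - r) * poissonKer r (x - θ) := by ring
  rw [intervalIntegral.integral_const_mul, integral_poissonKer_sub hr0 hr1, mul_one] at h2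
  unfold poissonStieltjes
  calc _ ≤ B * (1 / (1 - r)) + B * (1 / (1 - r)) + B / (1 - r) :=
        (abs_sub _ _).trans (add_le_add ((abs_sub _ _).trans
          (add_le_add (h1 _ ⟨hle, le_rfl⟩) (h1 _ ⟨le_rfl, hle⟩))) h2)
    _ = _ := by ring

/-- For a function that is periodic up to a constant the interval of integration can be shifted. -/
theorem poissonStieltjes_shift (hr0 : 0 ≤ r) (hr1 : r < 1) {N : ℝ → ℝ} (hN : Continuous N)
    {c : ℝ} (hc : ∀ x, N (x + 2 * Real.pi) = N x + c) (a b θ : ℝ) :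
    poissonStieltjes N a (a + 2 * Real.pi) r θ = poissonStieltjes N b (b + 2 * Real.pi) r θ := by
  have hpi := Real.pi_pos
  set k := c / (2 * Real.pi) with hk
  have hkc : k * (2 * Real.pi) = c := by rw [hk]; field_simp
  have hper : Function.Periodic (fun x => N x - k * x) (2 * Real.pi) := by
    intro x
    simp only [hc]
    linear_combination -hkc
  -- Subtracting the linear part makes `N` periodic; the linear part itself contributes the constant
  -- `k`, since the kernel has mass one.
  have hcont : Continuous fun x => N x - k * x := by fun_prop
  have key : ∀ a, poissonStieltjes N a (a + 2 * Real.pi) r θ =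
      k - ∫ φ in (0 : ℝ)..(0 + 2 * Real.pi), (N φ - k * φ) * poissonKerDeriv r (φ - θ) := by
    intro a
    have h1 := poissonStieltjes_add hr0 hr1 (hcont.intervalIntegrable a (a + 2 * Real.pi))
      ((by fun_prop : Continuous fun x : ℝ => k * x).intervalIntegrable a (a + 2 * Real.pi)) θ
    simp only [sub_add_cancel] at h1
    have h2 := poissonStieltjes_of_hasDerivAt hr0 hr1 (N := fun x => k * x) (N' := fun _ => k)
      (fun x => by simpa using (hasDerivAt_id x).const_mul k) continuous_const a
      (a + 2 * Real.pi) θ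
    rw [intervalIntegral.integral_const_mul, integral_poissonKer_sub hr0 hr1, mul_one] at h2
    have hper2 : Function.Periodic (fun φ => (N φ - k * φ) * poissonKerDeriv r (φ - θ))
        (2 * Real.pi) := by
      refine hper.mul ?_
      intro φ
      simp only []
      rw [add_sub_right_comm, poissonKerDeriv_periodic r]
    rw [h1, h2, poissonStieltjes, hper2.intervalIntegral_add_eq a 0, add_sub_right_comm,
      poissonKer_periodic r]
    linear_combination poissonKer r (a - θ) * hper a
  rw [key a, key b]

/-- As the kernel is even and its derivative odd, only symmetric differences of `N` about `θ` enter.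
-/
theorem poissonStieltjes_symm (hr0 : 0 ≤ r) (hr1 : r < 1) {N : ℝ → ℝ}
    (hN : ∀ a b, IntervalIntegrable N MeasureTheory.volume a b) (δ θ : ℝ) :
    poissonStieltjes N (θ - δ) (θ + δ) r θ = poissonKer r δ * (N (θ + δ) - N (θ - δ)) -
      ∫ t in (0 : ℝ)..δ, (N (θ + t) - N (θ - t)) * poissonKerDeriv r t := by
  have h0 := fun a b => intervalIntegrable_mul_poissonKerDeriv hr0 hr1 (hN a b) θ
  have h1 : ∫ t in (0 : ℝ)..δ, N (θ + t) * poissonKerDeriv r t =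
      ∫ φ in θ..(θ + δ), N φ * poissonKerDeriv r (φ - θ) := by
    have := intervalIntegral.integral_comp_add_left (a := 0) (b := δ)
      (fun φ => N φ * poissonKerDeriv r (φ - θ)) θ
    simpa using this
  have h2 : ∫ t in (0 : ℝ)..δ, N (θ - t) * poissonKerDeriv r t =
      -∫ φ in (θ - δ)..θ, N φ * poissonKerDeriv r (φ - θ) := by
    have := intervalIntegral.integral_comp_sub_left (a := 0) (b := δ)
      (fun φ => N φ * poissonKerDeriv r (φ - θ)) θ
    rw [sub_zero] at this
    rw [← this, ← intervalIntegral.integral_neg]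
    refine intervalIntegral.integral_congr fun t _ => ?_
    change _ = -(N (θ - t) * poissonKerDeriv r (θ - t - θ))
    rw [show θ - t - θ = -t by ring, poissonKerDeriv_neg]
    ring
  have hi1 : IntervalIntegrable (fun t => N (θ + t) * poissonKerDeriv r t)
      MeasureTheory.volume 0 δ := by
    have := (h0 (0 + θ) (δ + θ)).comp_add_right θ
    simpa [add_comm θ] using this
  have hi2 : IntervalIntegrable (fun t => N (θ - t) * poissonKerDeriv r t)
      MeasureTheory.volume 0 δ := by
    have := ((hN (θ - 0) (θ - δ)).comp_sub_left θ).mul_continuousOn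
      (continuous_poissonKerDeriv hr0 hr1).continuousOn
    simpa using this
  simp only [sub_mul]
  rw [intervalIntegral.integral_sub hi1 hi2, h1, h2, poissonStieltjes,
    ← intervalIntegral.integral_add_adjacent_intervals (h0 (θ - δ) θ) (h0 θ (θ + δ)),
    add_sub_cancel_left, show θ - δ - θ = -δ by ring, poissonKer_neg]
  ring

end

/-! ### Radial lower limits of Poisson–Stieltjes integrals -/

/-- Localisation: at distance at least `δ` from `θ`, the kernel and its derivative are both `O(1 -
r)`. -/
theorem exists_abs_poissonStieltjes_sub_le {N : ℝ → ℝ} (hN : Continuous N) (θ : ℝ) {δ : ℝ}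
    (hδ0 : 0 < δ) (hδ : δ ≤ Real.pi) : ∃ C, ∀ r : ℝ, 1 / 2 ≤ r → r < 1 →
    |poissonStieltjes N (θ - Real.pi) (θ + Real.pi) r θ -
      poissonStieltjes N (θ - δ) (θ + δ) r θ| ≤ C * (1 - r) := by
  have hDc : Continuous fun t => N (θ + t) - N (θ - t) := by fun_prop
  obtain ⟨B, hB⟩ := (isCompact_Icc (a := 0) (b := Real.pi)).exists_bound_of_continuousOn
    hDc.continuousOn
  have hB0 : 0 ≤ B := (norm_nonneg _).trans (hB δ ⟨hδ0.le, hδ⟩)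
  set κ := 1 - Real.cos δ with hκ
  refine ⟨B / κ + B / κ + B * (2 / κ ^ 2) * |Real.pi - δ|, fun r hr hr1 => ?_⟩
  have hr0 : 0 ≤ r := by linarith
  have hint : ∀ a b, IntervalIntegrable (fun t => (N (θ + t) - N (θ - t)) * poissonKerDeriv r t)
      MeasureTheory.volume a b := fun a b =>
    (hDc.mul (continuous_poissonKerDeriv hr0 hr1)).intervalIntegrable a b
  have hsplit := intervalIntegral.integral_interval_sub_left (hint 0 Real.pi) (hint 0 δ)
  rw [poissonStieltjes_symm hr0 hr1 (fun a b => hN.intervalIntegrable a b) Real.pi θ,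
    poissonStieltjes_symm hr0 hr1 (fun a b => hN.intervalIntegrable a b) δ θ]
  have hb : ∀ t ∈ Icc δ Real.pi, |poissonKer r t * (N (θ + t) - N (θ - t))| ≤
      B / κ * (1 - r) := by
    intro t ht
    rw [abs_mul, abs_of_pos (poissonKer_pos hr0 hr1 t)]
    calc _ ≤ (1 - r) / κ * B := mul_le_mul (poissonKer_le_of_le hr hr1 hδ0 ht.1 ht.2).1
            (hB t ⟨hδ0.le.trans ht.1, ht.2⟩) (abs_nonneg _)
            ((poissonKer_pos hr0 hr1 t).le.trans (poissonKer_le_of_le hr hr1 hδ0 ht.1 ht.2).1)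
      _ = _ := by ring
  have hi : |∫ t in δ..Real.pi, (N (θ + t) - N (θ - t)) * poissonKerDeriv r t| ≤
      B * (2 * (1 - r) / κ ^ 2) * |Real.pi - δ| := by
    refine intervalIntegral.norm_integral_le_of_norm_le_const
      (f := fun t => (N (θ + t) - N (θ - t)) * poissonKerDeriv r t) fun t ht => ?_
    rw [uIoc_of_le hδ] at ht
    rw [norm_mul]
    exact mul_le_mul (hB t ⟨hδ0.le.trans ht.1.le, ht.2⟩)
      (poissonKer_le_of_le hr hr1 hδ0 ht.1.le ht.2).2 (norm_nonneg _) hB0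
  have h1 := hb Real.pi ⟨hδ, le_rfl⟩
  have h2 := hb δ ⟨le_rfl, hδ⟩
  have h3 : (B / κ + B / κ + B * (2 / κ ^ 2) * |Real.pi - δ|) * (1 - r) =
      B / κ * (1 - r) + B / κ * (1 - r) + B * (2 * (1 - r) / κ ^ 2) * |Real.pi - δ| := by ring
  rw [h3, abs_le]
  rw [abs_le] at h1 h2 hi
  constructor <;> linarith [h1.1, h1.2, h2.1, h2.2, hi.1, hi.2]

theorem poissonStieltjes_symm_nonneg {r : ℝ} (hr0 : 0 ≤ r) (hr1 : r < 1) {N : ℝ → ℝ}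
    (hN : ∀ a b, IntervalIntegrable N MeasureTheory.volume a b) {δ θ : ℝ} (hδ0 : 0 < δ)
    (hδ : δ ≤ Real.pi) (h : ∀ t, 0 < t → t ≤ δ → N (θ - t) ≤ N (θ + t)) :
    0 ≤ poissonStieltjes N (θ - δ) (θ + δ) r θ := by
  rw [poissonStieltjes_symm hr0 hr1 hN]
  have h1 : 0 ≤ poissonKer r δ * (N (θ + δ) - N (θ - δ)) :=
    mul_nonneg (poissonKer_pos hr0 hr1 δ).le (sub_nonneg.2 (h δ hδ0 le_rfl))
  have h2 : ∫ t in (0 : ℝ)..δ, (N (θ + t) - N (θ - t)) * poissonKerDeriv r t ≤ 0 := by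
    rw [← neg_nonneg, ← intervalIntegral.integral_neg]
    refine intervalIntegral.integral_nonneg hδ0.le fun t ht => ?_
    rcases ht.1.eq_or_lt with h0 | h0
    · simp [← h0]
    · rw [← mul_neg]
      exact mul_nonneg (sub_nonneg.2 (h t h0 ht.2))
        (neg_nonneg.2 (poissonKerDeriv_nonpos hr0 hr1 ht.1 (ht.2.trans hδ)))
  linarith

/-- Subtracting `y * x` from `F` lowers its Poisson integral over a full period by exactly `y`. The
remainder plus `E` has nonnegative symmetric increments near `θ`, hence a nonnegative local
contribution; the rest is `O(1 - r)` for the remainder and nonnegative for `E`. -/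
theorem eventually_le_poissonStieltjes_add {F E : ℝ → ℝ} (hF : Continuous F) {c : ℝ}
    (hc : ∀ x, F (x + 2 * Real.pi) = F x + c) (hE : Monotone E) {y θ δ α β : ℝ}
    (hδ0 : 0 < δ) (hδ : δ ≤ Real.pi) (hα : α ≤ θ - δ) (hβ : θ + δ ≤ β)
    (h : ∀ t, 0 < t → t ≤ δ → y * (2 * t) - (F (θ + t) - F (θ - t)) ≤ E (θ + t) - E (θ - t))
    {η : ℝ} (hη : 0 < η) :
    ∀ᶠ r in 𝓝[<] (1 : ℝ), y - η ≤
      poissonStieltjes F (-Real.pi) Real.pi r θ + poissonStieltjes E α β r θ := by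
  set N : ℝ → ℝ := fun x => F x - y * x with hNdef
  have hN : Continuous N := by fun_prop
  obtain ⟨C, hC⟩ := exists_abs_poissonStieltjes_sub_le hN θ hδ0 hδ
  have hlim : Tendsto (fun r : ℝ => C * (1 - r)) (𝓝[<] 1) (𝓝 0) := by
    have : Tendsto (fun r : ℝ => C * (1 - r)) (𝓝 1) (𝓝 (C * (1 - 1))) :=
      Continuous.tendsto (by fun_prop) 1
    rw [sub_self, mul_zero] at this
    exact this.mono_left nhdsWithin_le_nhds
  filter_upwards [hlim.eventually_lt_const hη, Ioo_mem_nhdsLT (show (1 / 2 : ℝ) < 1 by norm_num)]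
    with r h1 h2
  have hr0 : 0 ≤ r := by linarith [h2.1]
  have hr1 := h2.2
  have hEi : ∀ a b, IntervalIntegrable E MeasureTheory.volume a b :=
    fun a b => hE.intervalIntegrable
  have hNi : ∀ a b, IntervalIntegrable N MeasureTheory.volume a b :=
    fun a b => hN.intervalIntegrable a b
  have e1 : poissonStieltjes F (-Real.pi) Real.pi r θ =
      poissonStieltjes F (θ - Real.pi) (θ + Real.pi) r θ := by
    have := poissonStieltjes_shift hr0 hr1 hF hc (-Real.pi) (θ - Real.pi) θ
    rwa [show -Real.pi + 2 * Real.pi = Real.pi by ring,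
      show θ - Real.pi + 2 * Real.pi = θ + Real.pi by ring] at this
  have e2 : poissonStieltjes F (θ - Real.pi) (θ + Real.pi) r θ =
      poissonStieltjes N (θ - Real.pi) (θ + Real.pi) r θ + y := by
    have h3 := poissonStieltjes_add hr0 hr1 (hNi (θ - Real.pi) (θ + Real.pi))
      ((by fun_prop : Continuous fun x : ℝ => y * x).intervalIntegrable _ _) θ
    simp only [hNdef, sub_add_cancel] at h3
    have h4 := poissonStieltjes_of_hasDerivAt hr0 hr1 (N := fun x => y * x) (N' := fun _ => y)
      (fun x => by simpa using (hasDerivAt_id x).const_mul y) continuous_const (θ - Real.pi)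
      (θ + Real.pi) θ
    rw [intervalIntegral.integral_const_mul,
      show θ + Real.pi = θ - Real.pi + 2 * Real.pi by ring,
      integral_poissonKer_sub hr0 hr1, mul_one] at h4
    rw [show θ + Real.pi = θ - Real.pi + 2 * Real.pi by ring] at h3 ⊢
    rw [h4] at h3
    exact h3
  have e3 : poissonStieltjes E (θ - δ) (θ + δ) r θ ≤ poissonStieltjes E α β r θ := by
    rw [← poissonStieltjes_add_adjacent hr0 hr1 hEi α (θ - δ) β,
      ← poissonStieltjes_add_adjacent hr0 hr1 hEi (θ - δ) (θ + δ) β]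
    linarith [poissonStieltjes_nonneg hr0 hr1 hE hα θ, poissonStieltjes_nonneg hr0 hr1 hE hβ θ]
  have e4 := poissonStieltjes_symm_nonneg hr0 hr1 (N := fun x => N x + E x)
    (fun a b => (hNi a b).add (hEi a b)) hδ0 hδ (θ := θ) (fun t ht0 ht => by
      have := h t ht0 ht
      simp only [hNdef]
      linarith)
  rw [poissonStieltjes_add hr0 hr1 (hNi _ _) (hEi _ _)] at e4
  have e5 := (abs_le.1 (hC r h2.1.le hr1)).1
  linarith

/-! ### Growth of harmonic functions in terms of the Alexiewicz norm -/

theorem hkIntegral_of_continuous {v : ℝ → ℝ} (hv : Continuous v) {a b : ℝ} (hab : a < b) :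
    hkIntegral v a b = ∫ x in a..b, v x := by
  have h1 : ContinuousOn (fun x : Fin 1 → ℝ => v (x 0)) (BoxIntegral.Box.Icc (ivl a b hab)) :=
    (hv.comp (continuous_apply 0)).continuousOn
  have h2 := (MeasureTheory.ContinuousOn.hasBoxIntegral MeasureTheory.volume h1
    BoxIntegral.IntegrationParams.Henstock).integral_eq
  rw [hkIntegral, dif_pos hab]
  refine h2.trans ?_
  have h3 : ((ivl a b hab : BoxIntegral.Box (Fin 1)) : Set (Fin 1 → ℝ)) =
      (MeasurableEquiv.funUnique (Fin 1) ℝ) ⁻¹' Ioc a b := by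
    ext x
    constructor
    · intro hx; exact hx 0
    · intro hx i
      rw [Subsingleton.elim i 0]
      exact hx
  rw [h3, intervalIntegral.integral_of_le hab.le]
  exact (MeasureTheory.volume_preserving_funUnique (Fin 1) ℝ).setIntegral_preimage_emb
    (MeasurableEquiv.measurableEmbedding _) v (Ioc a b)

theorem abs_hkIntegral_le_of_alexiewiczNorm_le {v : ℝ → ℝ} {B : ℝ} (hB : 0 ≤ B)
    (h : alexiewiczNorm v ≤ ENNReal.ofReal B) {a b : ℝ} (hab : a < b)
    (hlen : b - a ≤ 2 * Real.pi) : |hkIntegral v a b| ≤ B := by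
  have : ENNReal.ofReal |hkIntegral v a b| ≤ alexiewiczNorm v :=
    le_iSup_of_le a (le_iSup_of_le b (le_iSup_of_le ⟨hab, hlen⟩ le_rfl))
  exact (ENNReal.ofReal_le_ofReal_iff hB).1 (this.trans h)

theorem continuous_circleFun {u : ℂ → ℝ} (hu : ContinuousOn u (Metric.ball 0 1)) {R : ℝ}
    (hR0 : 0 ≤ R) (hR1 : R < 1) : Continuous (circleFun u R) := by
  refine hu.comp_continuous (by fun_prop) fun θ => ?_
  rw [mem_ball_zero_iff]
  exact norm_mul_exp_lt_one hR0 hR1 θ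

/-- In the Poisson formula on the circle of radius `R`, integrate by parts: the primitive of `u_R`
from `0` is bounded on a period by its Alexiewicz norm. -/
theorem abs_circleFun_le {u : ℂ → ℝ}
    (hu : InnerProductSpace.HarmonicOnNhd u (Metric.ball (0 : ℂ) 1)) {r R B : ℝ} (hr0 : 0 ≤ r)
    (hr : r < R) (hR : R < 1) (hB0 : 0 ≤ B)
    (hB : alexiewiczNorm (circleFun u R) ≤ ENNReal.ofReal B) (θ : ℝ) :
    |circleFun u r θ| ≤ 3 * B / (R - r) := by
  have hR0 : 0 < R := hr0.trans_lt hr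
  have hpi := Real.pi_pos
  have hv := continuous_circleFun hu.continuousOn hR0.le hR
  have hs0 : 0 ≤ r / R := div_nonneg hr0 hR0.le
  have hs1 : r / R < 1 := (div_lt_one hR0).2 hr
  set U : ℝ → ℝ := fun x => ∫ y in (0 : ℝ)..x, circleFun u R y with hU
  have hUd : ∀ x, HasDerivAt U (circleFun u R x) x := fun x =>
    intervalIntegral.integral_hasDerivAt_right (hv.intervalIntegrable _ _)
      hv.aestronglyMeasurable.stronglyMeasurableAtFilter hv.continuousAt
  have hUB : ∀ x ∈ Icc (0 : ℝ) (0 + 2 * Real.pi), |U x| ≤ B := by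
    intro x hx
    rw [zero_add] at hx
    rcases hx.1.eq_or_lt with h | h
    · simpa [hU, ← h] using hB0
    · simp only [hU]
      rw [← hkIntegral_of_continuous hv h]
      exact abs_hkIntegral_le_of_alexiewiczNorm_le hB0 hB h (by linarith [hx.2])
  have h1 := eq_integral_poissonKer (u := u) (R := R) (r := r) (θ := θ)
    (hu.mono (Metric.closedBall_subset_ball hR)) hr0 hr
  have h2 := poissonStieltjes_of_hasDerivAt hs0 hs1 hUd hv 0 (0 + 2 * Real.pi) θ
  have h3 := abs_poissonStieltjes_le hs0 hs1 hUB θ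
  have h4 : circleFun u r θ = poissonStieltjes U 0 (0 + 2 * Real.pi) (r / R) θ := by
    rw [h2, circleFun, h1, zero_add]
    refine intervalIntegral.integral_congr fun φ _ => ?_
    simp only [circleFun, circleMap, zero_add]
    ring
  rw [h4]
  refine h3.trans ?_
  have h5 : 0 < R - r := by linarith
  have h6 : R - r ≤ 1 - r / R := by
    rw [one_sub_div hR0.ne', le_div_iff₀ hR0]; nlinarith
  gcongr

theorem exists_forall_circleFun_le {u : ℂ → ℝ}
    (hu : InnerProductSpace.HarmonicOnNhd u (Metric.ball (0 : ℂ) 1))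
    (hgrowth : Tendsto (fun r : ℝ => ENNReal.ofReal (1 - r) * alexiewiczNorm (circleFun u r))
      (𝓝[<] 1) (𝓝 0)) {ε : ℝ} (hε : 0 < ε) :
    ∃ ρ < 1, 0 ≤ ρ ∧ ∀ r θ : ℝ, ρ < r → r < 1 → |circleFun u r θ| ≤ ε / (1 - r) ^ 2 := by
  have h1 : ∀ᶠ r : ℝ in 𝓝[<] 1,
      ENNReal.ofReal (1 - r) * alexiewiczNorm (circleFun u r) < ENNReal.ofReal (ε / 12) :=
    hgrowth.eventually_lt_const (ENNReal.ofReal_pos.2 (by positivity))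
  obtain ⟨ρ, hρ, h⟩ := mem_nhdsLT_iff_exists_Ioo_subset.1 h1
  refine ⟨max ρ 0, max_lt hρ one_pos, le_max_right _ _, fun r θ hr hr1 => ?_⟩
  have hr0 : 0 ≤ r := (le_max_right _ _).trans hr.le
  -- At the midpoint both `1 - R` and `R - r` equal `(1 - r) / 2`; this and the factor `3` of
  -- `abs_circleFun_le` account for `ε / 12`.
  set R := (1 + r) / 2 with hR
  have hd : 0 < 1 - r := by linarith
  have hR1 : 1 - R = (1 - r) / 2 := by rw [hR]; ring
  have hRr : R - r = (1 - r) / 2 := by rw [hR]; ring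
  have h2 : ENNReal.ofReal (1 - R) * alexiewiczNorm (circleFun u R) < ENNReal.ofReal (ε / 12) :=
    h ⟨by linarith [(le_max_left ρ 0).trans_lt hr], by linarith⟩
  have h3 : alexiewiczNorm (circleFun u R) ≤ ENNReal.ofReal (ε / 12 / (1 - R)) := by
    rw [ENNReal.ofReal_div_of_pos (by linarith), ENNReal.le_div_iff_mul_le
      (Or.inl (ENNReal.ofReal_pos.2 (by linarith)).ne') (Or.inl ENNReal.ofReal_ne_top), mul_comm]
    exact h2.le
  refine (abs_circleFun_le hu hr0 (by linarith) (by linarith)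
    (div_nonneg (by positivity) (by linarith)) h3 θ).trans (le_of_eq ?_)
  rw [hR1, hRr]
  field_simp
  norm_num

/-! ### Primitives of periodic functions -/

theorem HKIntegrable.neg {f : ℝ → ℝ} {a b : ℝ} (hf : HKIntegrable f a b) :
    HKIntegrable (fun x => -f x) a b :=
  let ⟨h, hi⟩ := hf
  ⟨h, hi.neg⟩

theorem hkIntegral_neg (f : ℝ → ℝ) (a b : ℝ) :
    hkIntegral (fun x => -f x) a b = -hkIntegral f a b := by
  unfold hkIntegral
  split_ifs
  · exact BoxIntegral.integral_neg
  · exact neg_zero.symm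

theorem hkPrimitive_neg (f : ℝ → ℝ) (x : ℝ) :
    hkPrimitive (fun x => -f x) x = -hkPrimitive f x := by
  unfold hkPrimitive
  rw [hkIntegral_neg, hkIntegral_neg]
  ring

theorem alexiewiczNorm_neg (f : ℝ → ℝ) : alexiewiczNorm (fun x => -f x) = alexiewiczNorm f := by
  simp only [alexiewiczNorm, hkIntegral_neg, abs_neg]

/-- Cousin's lemma: a tagged partition subordinate to the gauge `δ` exists, and the increments of
`ψ` over it are nonnegative and telescope. -/
theorem le_of_forall_exists_straddle_le {ψ : ℝ → ℝ} {a b : ℝ} (hab : a < b)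
    (h : ∀ θ ∈ Icc a b, ∃ δ > 0, ∀ l u, l < u → θ - δ ≤ l → l ≤ θ → θ ≤ u → u ≤ θ + δ → ψ l ≤ ψ u) :
    ψ a ≤ ψ b := by
  choose! δ hδ0 hδ using h
  classical
  set r : (Fin 1 → ℝ) → Ioi (0 : ℝ) := fun x =>
    if hx : x 0 ∈ Icc a b then ⟨δ (x 0), hδ0 _ hx⟩ else ⟨1, Set.mem_Ioi.2 one_pos⟩ with hr
  obtain ⟨π, hp, hh, hs, -⟩ :=
    (ivl a b hab).exists_taggedPartition_isHenstock_isSubordinate_homothetic r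
  rw [← sub_nonneg, ← sum_increment ψ hp]
  refine Finset.sum_nonneg fun J hJ => sub_nonneg.2 ?_
  have htag : π.tag J 0 ∈ Icc a b :=
    ⟨(π.tag_mem_Icc J).1 0, (π.tag_mem_Icc J).2 0⟩
  have hrJ : (r (π.tag J) : ℝ) = δ (π.tag J 0) := by simp only [hr, dif_pos htag]
  have h1 := (dist_le_pi_dist J.lower (π.tag J) 0).trans
    (Metric.mem_closedBall.1 (hs J hJ J.lower_mem_Icc))
  have h2 := (dist_le_pi_dist J.upper (π.tag J) 0).trans
    (Metric.mem_closedBall.1 (hs J hJ J.upper_mem_Icc))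
  rw [hrJ, Real.dist_eq, abs_le] at h1 h2
  exact hδ _ htag _ _ (J.lower_lt_upper 0) (by linarith [h1.1]) ((hh J hJ).1 0) ((hh J hJ).2 0)
    (by linarith [h2.2])

/-- A major function of `f` at `x` minus a minor function of `f` at `x + p` increases across each
point, as both compare with the same value of `f`. The auxiliary functions cost at most `ε`. Applied
to `-f` as well, this makes `F (x + p) - F x` constant. -/
theorem hkPrimitive_add_sub_le {f : ℝ → ℝ} (hf : ∀ a b : ℝ, a < b → HKIntegrable f a b) {p : ℝ}
    (hp : Function.Periodic f p) {a b : ℝ} (hab : a < b) :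
    hkPrimitive f (b + p) - hkPrimitive f b ≤ hkPrimitive f (a + p) - hkPrimitive f a := by
  refine le_of_forall_pos_le_add fun ε hε => ?_
  obtain ⟨E₁, -, hE0, hE1, hE⟩ := exists_monotone_majorant hf
    (show a - 1 < b + 1 by linarith) (half_pos hε)
  obtain ⟨G, -, hG0, hG1, hG⟩ := exists_monotone_majorant (fun a b h => (hf a b h).neg)
    (show a + p - 1 < b + p + 1 by linarith) (half_pos hε)
  have key := le_of_forall_exists_straddle_le
    (ψ := fun x => hkPrimitive f x + E₁ x + G (x + p) - hkPrimitive f (x + p)) hab (by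
      intro θ hθ
      obtain ⟨δ₁, hδ₁, h1⟩ := hE θ ⟨by linarith [hθ.1], by linarith [hθ.2]⟩
      obtain ⟨δ₂, hδ₂, h2⟩ := hG (θ + p) ⟨by linarith [hθ.1], by linarith [hθ.2]⟩
      refine ⟨min δ₁ δ₂, lt_min hδ₁ hδ₂, fun l u hlu hl hlθ hθu hu => ?_⟩
      have e1 := min_le_left δ₁ δ₂
      have e2 := min_le_right δ₁ δ₂
      have h3 := h1 l u hlu (by linarith) hlθ hθu (by linarith)
      have h4 := h2 (l + p) (u + p) (by linarith) (by linarith) (by linarith) (by linarith)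
        (by linarith)
      rw [hkPrimitive_neg, hkPrimitive_neg, hp θ] at h4
      linarith)
  linarith [hE0 a, hE1 b, hG0 (a + p), hG1 (b + p)]

theorem exists_hkPrimitive_add_eq {f : ℝ → ℝ} (hf : ∀ a b : ℝ, a < b → HKIntegrable f a b) {p : ℝ}
    (hp : Function.Periodic f p) : ∃ c, ∀ x, hkPrimitive f (x + p) = hkPrimitive f x + c := by
  have key : ∀ a b, a < b →
      hkPrimitive f (b + p) - hkPrimitive f b = hkPrimitive f (a + p) - hkPrimitive f a := by
    intro a b hab
    refine le_antisymm (hkPrimitive_add_sub_le hf hp hab) ?_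
    have := hkPrimitive_add_sub_le (fun a b h => (hf a b h).neg)
      (fun x => congrArg Neg.neg (hp x)) hab
    simp only [hkPrimitive_neg] at this
    linarith
  refine ⟨hkPrimitive f (0 + p) - hkPrimitive f 0, fun x => ?_⟩
  rcases lt_trichotomy x 0 with h | rfl | h
  · linarith [key x 0 h]
  · ring
  · linarith [key 0 x h]

/-! ### Comparison with the Poisson integral -/

/-- One half of the theorem: the maximum principle is applied to `u` minus the Poisson–Stieltjes
integral of the major function `F + E`. -/
theorem circleFun_le_poissonStieltjes {u : ℂ → ℝ} {f : ℝ → ℝ}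
    (hu : InnerProductSpace.HarmonicOnNhd u (Metric.ball (0 : ℂ) 1))
    (hp : Function.Periodic f (2 * Real.pi)) (hf : ∀ a b : ℝ, a < b → HKIntegrable f a b)
    (hlim : ∀ θ ∈ Ico (-Real.pi) Real.pi,
      Tendsto (fun r : ℝ => circleFun u r θ) (𝓝[<] 1) (𝓝 (f θ)))
    (hgrowth : Tendsto (fun r : ℝ => ENNReal.ofReal (1 - r) * alexiewiczNorm (circleFun u r))
      (𝓝[<] 1) (𝓝 0)) {r : ℝ} (hr0 : 0 ≤ r) (hr1 : r < 1) (θ : ℝ) :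
    circleFun u r θ ≤ poissonStieltjes (hkPrimitive f) (-Real.pi) Real.pi r θ := by
  have hpi := Real.pi_pos
  set F := hkPrimitive f with hFdef
  have hF : Continuous F := continuous_hkPrimitive hf
  obtain ⟨c, hc⟩ := exists_hkPrimitive_add_eq hf hp
  obtain ⟨B, hB⟩ := (isCompact_Icc (a := -Real.pi) (b := -Real.pi + 2 * Real.pi))
    |>.exists_bound_of_continuousOn hF.continuousOn
  have hB0 : 0 ≤ B := (norm_nonneg _).trans (hB (-Real.pi) ⟨le_rfl, by linarith⟩)
  obtain ⟨Hu, hHu, hHu'⟩ := hu.exists_analyticOnNhd_ball_re_eq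
  obtain ⟨HF, hHF, hHF'⟩ := exists_differentiableOn_re_eq_poissonStieltjes
    (hF.intervalIntegrable (-Real.pi) Real.pi)
  suffices h : ∀ ε > 0, circleFun u r θ ≤ poissonStieltjes F (-Real.pi) Real.pi r θ +
      ε / (1 - r) by
    refine le_of_forall_pos_le_add fun η hη => ?_
    have h1 : 0 < 1 - r := by linarith
    have := h (η * (1 - r)) (mul_pos hη h1)
    rwa [mul_div_cancel_right₀ _ h1.ne'] at this
  intro ε hε
  -- `E` is not periodic, so it is taken on an interval that contains a neighbourhood of every `θ`
  -- in `[-π, π)`, the point `-π` included.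
  obtain ⟨E, hE, hE0, hEε, hmaj⟩ := exists_monotone_majorant hf
    (show -(2 * Real.pi) < 2 * Real.pi by linarith) hε
  obtain ⟨HE, hHE, hHE'⟩ := exists_differentiableOn_re_eq_poissonStieltjes
    (hE.intervalIntegrable (μ := MeasureTheory.volume) (a := -(2 * Real.pi)) (b := 2 * Real.pi))
  have hαβ : -(2 * Real.pi) ≤ 2 * Real.pi := by linarith
  have hw := nonpos_of_forall_radial_limsup_nonpos (w := fun z => u z - (HF z).re - (HE z).re)
    ?_ ?_ ?_ _ (norm_mul_exp_lt_one hr0 hr1 θ)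
  · rw [hHF' r θ hr0 hr1, hHE' r θ hr0 hr1] at hw
    have h1 := poissonStieltjes_le hr0 hr1 hE hαβ θ
    have h2 : (E (2 * Real.pi) - E (-(2 * Real.pi))) / (1 - r) ≤ ε / (1 - r) := by
      have : 0 < 1 - r := by linarith
      gcongr
      linarith [hE0 (-(2 * Real.pi)), hEε (2 * Real.pi)]
    unfold circleFun
    linarith
  · intro z hz
    have hz' := mem_ball_zero_iff.2 hz
    have hn := Metric.isOpen_ball.mem_nhds hz'
    exact LocallyReAt.sub_re (LocallyReAt.sub_re
      ⟨Hu, hHu z hz', by filter_upwards [hn] with p hp using (hHu' hp).symm⟩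
      (hHF.analyticAt hn) (Eventually.of_forall fun _ => rfl))
      (hHE.analyticAt hn) (Eventually.of_forall fun _ => rfl)
  · intro η hη
    obtain ⟨ρ, hρ1, hρ0, hρ⟩ := exists_forall_circleFun_le hu hgrowth (half_pos hη)
    -- This radius makes `3 * B / (1 - ‖z‖)`, the bound for the integral of `dF`, at most half of
    -- the allowed growth; the integral of `dE` is nonnegative and only helps.
    refine ⟨max ρ (1 - η / (6 * (B + 1))), max_lt hρ1 (by
      have : 0 < η / (6 * (B + 1)) := by positivity
      linarith), fun z hz hz1 => ?_⟩
    have hzarg := Complex.norm_mul_exp_arg_mul_I z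
    have h1 := hρ ‖z‖ z.arg ((le_max_left _ _).trans_lt hz) hz1
    have h2 := hHF' ‖z‖ z.arg (norm_nonneg z) hz1
    have h3 := hHE' ‖z‖ z.arg (norm_nonneg z) hz1
    have h4 := poissonStieltjes_nonneg (norm_nonneg z) hz1 hE hαβ z.arg
    have h5 := abs_poissonStieltjes_le (norm_nonneg z) hz1 hB z.arg
    rw [show -Real.pi + 2 * Real.pi = Real.pi by ring] at h5
    rw [circleFun] at h1
    rw [hzarg] at h1 h2 h3
    have hd : 0 < 1 - ‖z‖ := by linarith
    have h6 : 3 * B / (1 - ‖z‖) ≤ η / 2 / (1 - ‖z‖) ^ 2 := by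
      rw [div_le_div_iff₀ hd (by positivity)]
      have h7 : 1 - ‖z‖ < η / (6 * (B + 1)) := by linarith [(le_max_right _ _).trans_lt hz]
      rw [lt_div_iff₀ (by positivity)] at h7
      nlinarith
    have h8 : η / (1 - ‖z‖) ^ 2 = η / 2 / (1 - ‖z‖) ^ 2 + η / 2 / (1 - ‖z‖) ^ 2 := by ring
    rw [h8]
    simp only [h2, h3]
    linarith [(abs_le.1 h1).2, (abs_le.1 h5).1]
  · intro θ hθ η hη
    obtain ⟨δ, hδ0, hδ⟩ := hmaj θ ⟨by linarith [hθ.1], by linarith [hθ.2]⟩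
    have h1 := eventually_le_poissonStieltjes_add hF hc hE (y := f θ) (θ := θ)
      (lt_min hδ0 hpi) (min_le_right δ Real.pi) (α := -(2 * Real.pi)) (β := 2 * Real.pi)
      (by linarith [hθ.1, min_le_right δ Real.pi]) (by linarith [hθ.2, min_le_right δ Real.pi])
      (fun t ht0 ht => by
        have ht' := ht.trans (min_le_left _ _)
        have := hδ (θ - t) (θ + t) (by linarith) (by linarith) (by linarith) (by linarith)
          (by linarith)
        rwa [show θ + t - (θ - t) = 2 * t by ring] at this) (half_pos hη)
    filter_upwards [h1, (hlim θ hθ).eventually_lt_const (show f θ < f θ + η / 2 by linarith),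
      Ioo_mem_nhdsLT (show (0 : ℝ) < 1 from one_pos)] with s h2 h3 hs
    simp only [hHF' s θ hs.1.le hs.2, hHE' s θ hs.1.le hs.2]
    rw [circleFun] at h3
    linarith

theorem circleFun_eq_poissonStieltjes {u : ℂ → ℝ} {f : ℝ → ℝ}
    (hu : InnerProductSpace.HarmonicOnNhd u (Metric.ball (0 : ℂ) 1))
    (hp : Function.Periodic f (2 * Real.pi)) (hf : ∀ a b : ℝ, a < b → HKIntegrable f a b)
    (hlim : ∀ θ ∈ Ico (-Real.pi) Real.pi,
      Tendsto (fun r : ℝ => circleFun u r θ) (𝓝[<] 1) (𝓝 (f θ)))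
    (hgrowth : Tendsto (fun r : ℝ => ENNReal.ofReal (1 - r) * alexiewiczNorm (circleFun u r))
      (𝓝[<] 1) (𝓝 0)) {r : ℝ} (hr0 : 0 ≤ r) (hr1 : r < 1) (θ : ℝ) :
    circleFun u r θ = poissonStieltjes (hkPrimitive f) (-Real.pi) Real.pi r θ := by
  refine le_antisymm (circleFun_le_poissonStieltjes hu hp hf hlim hgrowth hr0 hr1 θ) ?_
  have h := circleFun_le_poissonStieltjes (u := -u) (f := fun x => -f x) hu.neg
    (fun x => congrArg Neg.neg (hp x)) (fun a b h => (hf a b h).neg)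
    (fun θ hθ => (hlim θ hθ).neg)
    (by
      have : ∀ r, alexiewiczNorm (circleFun (-u) r) = alexiewiczNorm (circleFun u r) :=
        fun r => alexiewiczNorm_neg (circleFun u r)
      simpa only [this] using hgrowth) hr0 hr1 θ
  have h1 : hkPrimitive (fun x => -f x) = fun x => -hkPrimitive f x :=
    funext (hkPrimitive_neg f)
  have h2 : poissonStieltjes (fun x => -hkPrimitive f x) (-Real.pi) Real.pi r θ =
      -poissonStieltjes (hkPrimitive f) (-Real.pi) Real.pi r θ := by
    simp only [poissonStieltjes, neg_mul, intervalIntegral.integral_neg]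
    ring
  rw [h1, h2] at h
  have h3 : circleFun (-u) r θ = -circleFun u r θ := rfl
  linarith

theorem hasIntegral_mul_poissonKer {f : ℝ → ℝ} (hf : ∀ a b : ℝ, a < b → HKIntegrable f a b)
    {r : ℝ} (hr0 : 0 ≤ r) (hr1 : r < 1) (θ : ℝ) {a b : ℝ} (hab : a < b) :
    BoxIntegral.HasIntegral (ivl a b hab) BoxIntegral.IntegrationParams.Henstock
      (fun x : Fin 1 → ℝ => f (x 0) * poissonKer r (x 0 - θ)) BoxIntegral.BoxAdditiveMap.volume
      (poissonStieltjes (hkPrimitive f) a b r θ) :=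
  hasIntegral_mul hf (hasDerivAt_poissonKer_sub hr0 hr1 θ)
    (continuous_poissonKerDeriv_sub hr0 hr1 θ) hab

end HKDirichlet

end

theorem mainTheorem4 (u : ℂ → ℝ) (f : ℝ → ℝ)
    (hu : InnerProductSpace.HarmonicOnNhd u (Metric.ball (0 : ℂ) 1))
    (hf : HKDirichlet.MemHK f)
    (hlim : ∀ θ ∈ Set.Ico (-Real.pi) Real.pi,
      Tendsto (fun r : ℝ => HKDirichlet.circleFun u r θ) (𝓝[<] 1) (𝓝 (f θ)))
    (hgrowth : Tendsto
      (fun r : ℝ => ENNReal.ofReal (1 - r) *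
        HKDirichlet.alexiewiczNorm (HKDirichlet.circleFun u r)) (𝓝[<] 1) (𝓝 0)) :
    ∀ r θ : ℝ, 0 ≤ r → r < 1 →
      HKDirichlet.HKIntegrable (fun φ => f φ * HKDirichlet.poissonKer r (φ - θ))
        (-Real.pi) Real.pi ∧
      HKDirichlet.circleFun u r θ = HKDirichlet.poissonInt f r θ := by
  intro r θ hr0 hr1
  have hab : -Real.pi < Real.pi := by linarith [Real.pi_pos]
  have h := HKDirichlet.hasIntegral_mul_poissonKer hf.integrable hr0 hr1 θ hab
  refine ⟨⟨hab, h.integrable⟩, ?_⟩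
  rw [HKDirichlet.circleFun_eq_poissonStieltjes hu hf.periodic hf.integrable hlim hgrowth hr0 hr1 θ,
    HKDirichlet.poissonInt, HKDirichlet.hkIntegral, dif_pos hab]
  exact h.integral_eq.symm
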